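/- Let $n\ge 1$, let $X\in\mathbb R^{n\times n}$ be a matrix of rank $r$, and let $\mu_1\in\mathbb R$ satisfy $\|X\|_\infty\le \mu_1\sqrt{r/n^2}\,\|X\|$. Here $\|\cdot\|$ is the spectral norm, $\|\cdot\|_F$ the Frobenius norm, and $\|\cdot\|_\infty$ the maximum magnitude of the entries. Let $\Omega=(\omega_1,\dots,\omega_m)$ consist of $m$ indices drawn independently and uniformly, with replacement, from $\{1,\dots,n\}\times\{1,\dots,n\}$. Put $p=m/n^2$, and let $\mathcal P_\Omega(Z)$ be the entrywise product of $Z$ with $\sum_{k=1}^m e_{i_k}e_{j_k}^{*}$, where $\omega_k=(i_k,j_k)$ (repeated indices are counted with multiplicity). Let $X_0=\mathcal H_r\left(p^{-1}\mathcal P_\Omega(X)\right)$. Here $\mathcal H_r(Z)=P\Lambda_rQ^{*}$ for a singular value decomposition $Z=P\Lambda Q^{*}$ with singular values in nonincreasing order, and $\Lambda_r$ keeps the $r$ largest singular values and sets the others to zero. Then for every $\beta>1$, if $m\ge 6\beta n\log n$, with probability at least $1-2n^{1-\beta}$ the bound $$\|X_0-X\|_F\le\sqrt{\frac{64\,\beta\,\mu_1^2\,n\,r^2\log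 n}{3m}}\;\|X\|$$ holds, simultaneously for all choices of the singular value decomposition that defines $\mathcal H_r$. -/

import Mathlib

open MeasureTheory ProbabilityTheory
open scoped Matrix

namespace MatrixCompletion

/-- Spectral norm `‖A‖` (the operator norm for the Euclidean norm). -/
noncomputable def specNorm {n : ℕ} (A : Matrix (Fin n) (Fin n) ℝ) : ℝ :=
  ‖Matrix.toEuclideanCLM (n := Fin n) (𝕜 := ℝ) A‖

open scoped Matrix.Norms.Frobenius in
/-- Frobenius norm `‖A‖_F`. -/
noncomputable def frobNorm {n : ℕ} (A : Matrix (Fin n) (Fin n) ℝ) : ℝ := ‖A‖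

open scoped Matrix.Norms.Elementwise in
/-- Maximum magnitude of the entries, `‖A‖_∞`. -/
noncomputable def maxNorm {n : ℕ} (A : Matrix (Fin n) (Fin n) ℝ) : ℝ := ‖A‖

/-- The sampling operator `P_Ω`: the entrywise product with `∑_{(i,j) ∈ Ω} e_i e_jᵀ`, where
`Ω` is a family of `m` index pairs, counted with multiplicity. -/
def sampling {n m : ℕ} (Ω : Fin m → Fin n × Fin n) (Z : Matrix (Fin n) (Fin n) ℝ) :
    Matrix (Fin n) (Fin n) ℝ :=
  Z ⊙ ∑ k, Matrix.single (Ω k).1 (Ω k).2 (1 : ℝ)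

/-- `Z = P Λ Qᵀ` is a singular value decomposition, with `Λ = diag(s)`: `P` and `Q` are
orthogonal and the entries of `s` are nonnegative and nonincreasing. -/
structure IsSVD {n : ℕ} (Z P : Matrix (Fin n) (Fin n) ℝ) (s : Fin n → ℝ)
    (Q : Matrix (Fin n) (Fin n) ℝ) : Prop where
  left_mem : P ∈ Matrix.orthogonalGroup (Fin n) ℝ
  right_mem : Q ∈ Matrix.orthogonalGroup (Fin n) ℝ
  nonneg : ∀ i, 0 ≤ s i
  antitone : Antitone s
  eq : Z = P * Matrix.diagonal s * Qᵀ

/-- `Y` is a value of the hard thresholding operator `H_r` at `Z`: for some singular value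
decomposition of `Z`, all but the `r` largest singular values have been set to zero.
(The value is unique unless the `r`-th and the next singular value are equal and nonzero.) -/
def IsHardThresholding {n : ℕ} (r : ℕ) (Z Y : Matrix (Fin n) (Fin n) ℝ) : Prop :=
  ∃ (P : Matrix (Fin n) (Fin n) ℝ) (s : Fin n → ℝ) (Q : Matrix (Fin n) (Fin n) ℝ),
    IsSVD Z P s Q ∧
      Y = P * Matrix.diagonal (fun i : Fin n => if (i : ℕ) < r then s i else 0) * Qᵀ

/-- Every square real matrix has a singular value decomposition. -/
theorem exists_isSVD {n : ℕ} (Z : Matrix (Fin n) (Fin n) ℝ) :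
    ∃ (P : Matrix (Fin n) (Fin n) ℝ) (s : Fin n → ℝ) (Q : Matrix (Fin n) (Fin n) ℝ),
      IsSVD Z P s Q := by
  set T : EuclideanSpace ℝ (Fin n) →ₗ[ℝ] EuclideanSpace ℝ (Fin n) := Matrix.toEuclideanLin Z
    with hT
  have hn : Module.finrank ℝ (EuclideanSpace ℝ (Fin n)) = n := finrank_euclideanSpace_fin
  have hsym := T.isSymmetric_adjoint_comp_self
  set v := hsym.eigenvectorBasis hn with hv
  set s : Fin n → ℝ := fun i => T.singularValues i with hs
  have hs0 : ∀ i, 0 ≤ s i := fun i => T.singularValues_nonneg i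
  have hinner : ∀ i j, inner ℝ (T (v i)) (T (v j)) = if i = j then s i ^ 2 else 0 := by
    intro i j
    have h1 : inner ℝ (T (v i)) (T (v j)) = inner ℝ ((LinearMap.adjoint T ∘ₗ T) (v i)) (v j) := by
      simp [LinearMap.adjoint_inner_left]
    rw [h1, hv, hsym.apply_eigenvectorBasis hn i, inner_smul_left,
      orthonormal_iff_ite.mp (hsym.eigenvectorBasis hn).orthonormal i j]
    have := T.sq_singularValues_fin hn i
    simp [hs, this]
  set w : Fin n → EuclideanSpace ℝ (Fin n) := fun i => (s i)⁻¹ • T (v i) with hw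
  have hort : Orthonormal ℝ (({i | s i ≠ 0} : Set (Fin n)).domRestrict w) := by
    rw [orthonormal_iff_ite]
    rintro ⟨i, hi⟩ ⟨j, hj⟩
    change s i ≠ 0 at hi
    have h2 : inner ℝ (w i) (w j) = if i = j then (1 : ℝ) else 0 := by
      simp only [hw, inner_smul_left, inner_smul_right, hinner]
      split_ifs with h
      · subst h
        simp only [conj_trivial]
        field_simp
      · simp
    simp only [Subtype.mk.injEq]
    exact h2
  obtain ⟨u, hu⟩ := hort.exists_orthonormalBasis_extension_of_card_eq (by simp)
  have hTv : ∀ i, T (v i) = s i • u i := by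
    intro i
    by_cases hi : s i = 0
    · have := hinner i i
      simp [hi] at this
      simp [hi, this]
    · rw [hu i hi]
      simp [hw, smul_smul, hi]
  have horth : ∀ b : OrthonormalBasis (Fin n) ℝ (EuclideanSpace ℝ (Fin n)),
      (Matrix.of fun i j => b j i) ∈ Matrix.orthogonalGroup (Fin n) ℝ := by
    intro b
    rw [Matrix.mem_orthogonalGroup_iff']
    ext i j
    have := orthonormal_iff_ite.mp b.orthonormal i j
    rw [PiLp.inner_apply] at this
    simp only [RCLike.inner_apply, conj_trivial] at this
    rw [Matrix.mul_apply, Matrix.one_apply, ← this]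
    refine Finset.sum_congr rfl fun k _ => ?_
    simp [mul_comm]
  refine ⟨Matrix.of fun i j => u j i, s, Matrix.of fun i j => v j i, horth u, horth v, hs0,
    fun i j hij => T.singularValues_antitone hij, ?_⟩
  have hQ := (Matrix.mem_orthogonalGroup_iff (Fin n) ℝ).mp (horth v)
  have hZQ : Z * (Matrix.of fun i j => v j i)
      = (Matrix.of fun i j => u j i) * Matrix.diagonal s := by
    ext i j
    have h := congrArg (fun x : EuclideanSpace ℝ (Fin n) => x i) (hTv j)
    simp only [hT, PiLp.smul_apply, smul_eq_mul] at h
    rw [Matrix.mul_diagonal, Matrix.mul_apply, Matrix.of_apply, mul_comm, ← h]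
    simp [Matrix.toLpLin_apply, Matrix.mulVec, dotProduct]
  rw [← hZQ, Matrix.mul_assoc]
  rw [show (Matrix.of fun i j => v j i) * (Matrix.of fun i j => v j i)ᵀ = 1 from hQ,
    Matrix.mul_one]

/-- The hard thresholding operator takes at least one value at every matrix. -/
theorem exists_isHardThresholding {n : ℕ} (r : ℕ) (Z : Matrix (Fin n) (Fin n) ℝ) :
    ∃ Y, IsHardThresholding r Z Y := by
  obtain ⟨P, s, Q, h⟩ := exists_isSVD Z
  exact ⟨_, P, s, Q, h, rfl⟩

end MatrixCompletion

/-!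
If `Z` is close to a matrix `X` of rank at most `r` in spectral norm, so is `H_r(Z)`: by
Eckart–Young the discarded singular values are at most `‖Z - X‖`, so `‖H_r(Z) - X‖ ≤ 2 ‖Z - X‖`,
and since `H_r(Z) - X` has rank at most `2r` its Frobenius norm is at most `√(2r)` times that.
For `Z = p⁻¹ P_Ω(X)` the difference `Z - X` is an average of `m` independent centred matrices, one
per sampled entry, and the matrix Bernstein inequality bounds its spectral norm. Bernstein's
inequality is obtained with Ahlswede and Winter's method: Golden–Thompson,
`tr e^(A+B) ≤ tr (e^A e^B)`, splits the trace of the exponential of a sum of independent Hermitian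
matrices one summand at a time, and the Hermitian dilation reduces rectangular matrices to
Hermitian ones.
-/

namespace MatrixCompletion

section Trace

open RCLike
open scoped ComplexOrder

variable {ι 𝕜 : Type*} [Fintype ι]

theorem trace_mul_pow_comm {R : Type*} [CommSemiring R] [DecidableEq ι] (A B : Matrix ι ι R)
    (k : ℕ) : ((A * B) ^ k).trace = ((B * A) ^ k).trace := by
  cases k with
  | zero => simp
  | succ k =>
    have h : A * (B * A) ^ k = (A * B) ^ k * A :=
      (SemiconjBy.pow_right (mul_assoc A B A).symm k)
    rw [pow_succ (A * B), ← Matrix.mul_assoc, ← h, Matrix.mul_assoc, Matrix.trace_mul_comm,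
      Matrix.mul_assoc, ← pow_succ]

variable [RCLike 𝕜]

theorem re_trace_mul_conjTranspose_self_nonneg (A : Matrix ι ι 𝕜) : 0 ≤ re (A * Aᴴ).trace :=
  (nonneg_iff.1 (Matrix.posSemidef_self_mul_conjTranspose A).trace_nonneg).1

theorem re_trace_conjTranspose (A : Matrix ι ι 𝕜) : re Aᴴ.trace = re A.trace := by
  rw [Matrix.trace_conjTranspose, star_def, conj_re]

theorem re_trace_mul_self_le (A : Matrix ι ι 𝕜) : re (A * A).trace ≤ re (A * Aᴴ).trace := by
  have h := re_trace_mul_conjTranspose_self_nonneg (A - Aᴴ)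
  have h₁ : re (Aᴴ * Aᴴ).trace = re (A * A).trace := by
    rw [← Matrix.conjTranspose_mul, re_trace_conjTranspose]
  have h₂ : re (Aᴴ * A).trace = re (A * Aᴴ).trace := by rw [Matrix.trace_mul_comm]
  simp only [Matrix.conjTranspose_sub, Matrix.conjTranspose_conjTranspose, sub_mul, mul_sub,
    Matrix.trace_sub, map_sub] at h
  linarith

theorem two_mul_re_trace_mul_le {A B : Matrix ι ι 𝕜} (hA : A.IsHermitian) (hB : B.IsHermitian) :
    2 * re (A * B).trace ≤ re (A * A).trace + re (B * B).trace := by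
  have h := re_trace_mul_conjTranspose_self_nonneg (A - B)
  have h₁ : re (B * A).trace = re (A * B).trace := by rw [Matrix.trace_mul_comm]
  simp only [Matrix.conjTranspose_sub, hA.eq, hB.eq, sub_mul, mul_sub, Matrix.trace_sub,
    map_sub] at h
  linarith

variable [DecidableEq ι]

theorem re_trace_mul_pow_two_pow_succ_le {k : ℕ}
    (ih : ∀ P Q : Matrix ι ι 𝕜, P.IsHermitian → Q.IsHermitian →
      re ((P * Q) ^ 2 ^ k).trace ≤ re (P ^ 2 ^ k * Q ^ 2 ^ k).trace)
    (ih' : ∀ A : Matrix ι ι 𝕜, re (A ^ 2 ^ (k + 1)).trace ≤ re ((A * Aᴴ) ^ 2 ^ k).trace)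
    {P Q : Matrix ι ι 𝕜} (hP : P.IsHermitian) (hQ : Q.IsHermitian) :
    re ((P * Q) ^ 2 ^ (k + 1)).trace ≤ re (P ^ 2 ^ (k + 1) * Q ^ 2 ^ (k + 1)).trace :=
  calc re ((P * Q) ^ 2 ^ (k + 1)).trace ≤ re ((P * Q * (P * Q)ᴴ) ^ 2 ^ k).trace := ih' _
    _ = re ((P * (Q * Q * P)) ^ 2 ^ k).trace := by
      rw [Matrix.conjTranspose_mul, hP.eq, hQ.eq]; simp only [Matrix.mul_assoc]
    _ = re ((Q ^ 2 * P ^ 2) ^ 2 ^ k).trace := by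
      rw [trace_mul_pow_comm]; simp only [pow_two, Matrix.mul_assoc]
    _ = re ((P ^ 2 * Q ^ 2) ^ 2 ^ k).trace := by rw [trace_mul_pow_comm]
    _ ≤ re ((P ^ 2) ^ 2 ^ k * (Q ^ 2) ^ 2 ^ k).trace := ih _ _ (hP.pow 2) (hQ.pow 2)
    _ = _ := by rw [← pow_mul, ← pow_mul, ← pow_succ']

theorem re_trace_pow_two_pow_succ_le {k : ℕ}
    (ih : ∀ P Q : Matrix ι ι 𝕜, P.IsHermitian → Q.IsHermitian →
      re ((P * Q) ^ 2 ^ k).trace ≤ re (P ^ 2 ^ k * Q ^ 2 ^ k).trace)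
    (ih' : ∀ A : Matrix ι ι 𝕜, re (A ^ 2 ^ (k + 1)).trace ≤ re ((A * Aᴴ) ^ 2 ^ k).trace)
    (A : Matrix ι ι 𝕜) :
    re (A ^ 2 ^ (k + 1 + 1)).trace ≤ re ((A * Aᴴ) ^ 2 ^ (k + 1)).trace := by
  have hl := Matrix.isHermitian_conjTranspose_mul_self A
  have hr := Matrix.isHermitian_mul_conjTranspose_self A
  calc re (A ^ 2 ^ (k + 1 + 1)).trace = re ((A * A) ^ 2 ^ (k + 1)).trace := by
        rw [← pow_two, ← pow_mul, ← pow_succ']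
    _ ≤ re ((A * A * (A * A)ᴴ) ^ 2 ^ k).trace := ih' _
    _ = re ((A * (A * Aᴴ * Aᴴ)) ^ 2 ^ k).trace := by
      rw [Matrix.conjTranspose_mul]; simp only [Matrix.mul_assoc]
    _ = re ((A * Aᴴ * (Aᴴ * A)) ^ 2 ^ k).trace := by
      rw [trace_mul_pow_comm]; simp only [Matrix.mul_assoc]
    _ ≤ re ((A * Aᴴ) ^ 2 ^ k * (Aᴴ * A) ^ 2 ^ k).trace := ih _ _ hr hl
    _ ≤ re ((A * Aᴴ) ^ 2 ^ (k + 1)).trace := by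
      have h := two_mul_re_trace_mul_le (hr.pow (2 ^ k)) (hl.pow (2 ^ k))
      rw [← pow_two, ← pow_two, ← pow_mul, ← pow_mul, ← pow_succ, trace_mul_pow_comm Aᴴ A] at h
      linarith

theorem re_trace_mul_pow_two_pow_le {P Q : Matrix ι ι 𝕜} (hP : P.IsHermitian)
    (hQ : Q.IsHermitian) (k : ℕ) :
    re ((P * Q) ^ 2 ^ k).trace ≤ re (P ^ 2 ^ k * Q ^ 2 ^ k).trace := by
  suffices h : (∀ P Q : Matrix ι ι 𝕜, P.IsHermitian → Q.IsHermitian →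
      re ((P * Q) ^ 2 ^ k).trace ≤ re (P ^ 2 ^ k * Q ^ 2 ^ k).trace) ∧
      ∀ A : Matrix ι ι 𝕜, re (A ^ 2 ^ (k + 1)).trace ≤ re ((A * Aᴴ) ^ 2 ^ k).trace from
    h.1 P Q hP hQ
  induction k with
  | zero => exact ⟨fun P Q _ _ => by simp, fun A => by simpa [pow_two] using re_trace_mul_self_le A⟩
  | succ k ih =>
    exact ⟨fun P Q hP hQ => re_trace_mul_pow_two_pow_succ_le ih.1 ih.2 hP hQ,
      re_trace_pow_two_pow_succ_le ih.1 ih.2⟩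

end Trace

section Lie

open NormedSpace Filter Topology

theorem norm_pow_sub_pow_le {R : Type*} [NormedRing R] [NormOneClass R] {x y : R} {c : ℝ}
    (hx : ‖x‖ ≤ c) (hy : ‖y‖ ≤ c) (k : ℕ) :
    ‖x ^ (k + 1) - y ^ (k + 1)‖ ≤ (k + 1) * c ^ k * ‖x - y‖ := by
  have hc : 0 ≤ c := (norm_nonneg x).trans hx
  induction k with
  | zero => simp
  | succ k ih =>
    calc ‖x ^ (k + 1 + 1) - y ^ (k + 1 + 1)‖
        = ‖x * (x ^ (k + 1) - y ^ (k + 1)) + (x - y) * y ^ (k + 1)‖ := by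
          rw [pow_succ' x (k + 1), pow_succ' y (k + 1)]; noncomm_ring
      _ ≤ ‖x‖ * ‖x ^ (k + 1) - y ^ (k + 1)‖ + ‖x - y‖ * ‖y ^ (k + 1)‖ :=
          (norm_add_le _ _).trans (add_le_add (norm_mul_le _ _) (norm_mul_le _ _))
      _ ≤ c * ((k + 1) * c ^ k * ‖x - y‖) + ‖x - y‖ * c ^ (k + 1) := by
          gcongr
          exact (norm_pow_le _ _).trans (by gcongr)
      _ = (↑(k + 1) + 1) * c ^ (k + 1) * ‖x - y‖ := by push_cast; ring

variable {𝔸 : Type*} [NormedRing 𝔸]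

theorem norm_exp_le_exp_norm (𝕜 : Type*) [RCLike 𝕜] [NormOneClass 𝔸] [NormedAlgebra 𝕜 𝔸]
    (x : 𝔸) : ‖exp x‖ ≤ Real.exp ‖x‖ := by
  have h : HasSum (fun k : ℕ => ‖x‖ ^ k / (k.factorial : ℝ)) (Real.exp ‖x‖) := by
    rw [Real.exp_eq_exp_ℝ]
    exact expSeries_div_hasSum_exp ‖x‖
  rw [exp_eq_tsum 𝕜]
  refine tsum_of_norm_bounded h fun k => ?_
  rw [norm_smul, norm_inv, RCLike.norm_natCast, div_eq_inv_mul]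
  gcongr
  exact norm_pow_le _ _

variable (𝕜 : Type*) [RCLike 𝕜] [NormedAlgebra 𝕜 𝔸] [CompleteSpace 𝔸]

theorem hasDerivAt_exp_smul_mul_exp_smul_sub_exp_smul_add (a b : 𝔸) :
    HasDerivAt (fun t : 𝕜 => exp (t • a) * exp (t • b) - exp (t • (a + b))) 0 0 := by
  convert! ((hasDerivAt_exp_smul_const a (0 : 𝕜)).mul (hasDerivAt_exp_smul_const b 0)).sub
    (hasDerivAt_exp_smul_const (a + b) 0) using 1
  simp

theorem tendsto_mul_norm_exp_mul_exp_sub_exp_add (a b : 𝔸) :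
    Tendsto (fun k : ℕ => ((k : ℝ) + 1) * ‖exp (((k : 𝕜) + 1)⁻¹ • a) * exp (((k : 𝕜) + 1)⁻¹ • b)
      - exp (((k : 𝕜) + 1)⁻¹ • (a + b))‖) atTop (𝓝 0) := by
  have hk : Tendsto (fun k : ℕ => ((k : 𝕜) + 1)⁻¹) atTop (𝓝[≠] 0) :=
    tendsto_nhdsWithin_iff.2 ⟨by
      simpa [one_div] using tendsto_one_div_add_atTop_nhds_zero_nat (𝕜 := 𝕜),
      Eventually.of_forall fun k => inv_ne_zero k.cast_add_one_ne_zero⟩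
  have h := ((hasDerivAt_exp_smul_mul_exp_smul_sub_exp_smul_add 𝕜 a b).tendsto_slope_zero.comp
    hk).norm
  simp only [norm_zero] at h
  refine h.congr fun k => ?_
  have hnorm : ‖(k : 𝕜) + 1‖ = (k : ℝ) + 1 := by
    exact_mod_cast RCLike.norm_natCast (K := 𝕜) (k + 1)
  simp [norm_smul, hnorm]

theorem norm_exp_mul_exp_pow_sub_exp_add_le [NormOneClass 𝔸] (a b : 𝔸) (k : ℕ) :
    ‖(exp (((k : 𝕜) + 1)⁻¹ • a) * exp (((k : 𝕜) + 1)⁻¹ • b)) ^ (k + 1) - exp (a + b)‖ ≤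
      Real.exp (‖a‖ + ‖b‖) * (((k : ℝ) + 1) * ‖exp (((k : 𝕜) + 1)⁻¹ • a) *
        exp (((k : 𝕜) + 1)⁻¹ • b) - exp (((k : 𝕜) + 1)⁻¹ • (a + b))‖) := by
  let _ : NormedAlgebra ℚ 𝔸 := NormedAlgebra.restrictScalars ℚ 𝕜 𝔸
  have hexp (x : 𝔸) : ‖exp (((k : 𝕜) + 1)⁻¹ • x)‖ ≤ Real.exp (((k : ℝ) + 1)⁻¹ * ‖x‖) := by
    refine (norm_exp_le_exp_norm 𝕜 _).trans_eq ?_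
    rw [norm_smul, norm_inv, show ‖(k : 𝕜) + 1‖ = (k : ℝ) + 1 by
      exact_mod_cast RCLike.norm_natCast (K := 𝕜) (k + 1)]
  have hprod : ‖exp (((k : 𝕜) + 1)⁻¹ • a) * exp (((k : 𝕜) + 1)⁻¹ • b)‖ ≤
      Real.exp (((k : ℝ) + 1)⁻¹ * (‖a‖ + ‖b‖)) := by
    rw [mul_add, Real.exp_add]
    exact (norm_mul_le _ _).trans (by gcongr <;> exact hexp _)
  have hsum : ‖exp (((k : 𝕜) + 1)⁻¹ • (a + b))‖ ≤ Real.exp (((k : ℝ) + 1)⁻¹ * (‖a‖ + ‖b‖)) :=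
    (hexp _).trans (by gcongr; exact norm_add_le a b)
  have hpow : exp (((k : 𝕜) + 1)⁻¹ • (a + b)) ^ (k + 1) = exp (a + b) := by
    rw [← exp_nsmul, ← Nat.cast_smul_eq_nsmul 𝕜, smul_smul, Nat.cast_add_one,
      mul_inv_cancel₀ k.cast_add_one_ne_zero, one_smul]
  have hle : Real.exp (((k : ℝ) + 1)⁻¹ * (‖a‖ + ‖b‖)) ^ k ≤ Real.exp (‖a‖ + ‖b‖) := by
    rw [← Real.exp_nat_mul, ← mul_assoc, ← div_eq_mul_inv]
    gcongr
    exact mul_le_of_le_one_left (by positivity) (div_le_one_of_le₀ (by linarith) (by positivity))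
  calc _ ≤ ((k : ℝ) + 1) * Real.exp (((k : ℝ) + 1)⁻¹ * (‖a‖ + ‖b‖)) ^ k * ‖_‖ :=
        hpow ▸ norm_pow_sub_pow_le hprod hsum k
    _ ≤ ((k : ℝ) + 1) * Real.exp (‖a‖ + ‖b‖) * ‖_‖ := by gcongr
    _ = _ := by ring

/-- The Lie product formula. -/
theorem tendsto_exp_mul_exp_pow [NormOneClass 𝔸] (a b : 𝔸) :
    Tendsto (fun k : ℕ => (exp (((k : 𝕜) + 1)⁻¹ • a) * exp (((k : 𝕜) + 1)⁻¹ • b)) ^ (k + 1))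
      atTop (𝓝 (exp (a + b))) := by
  refine tendsto_iff_norm_sub_tendsto_zero.2 (squeeze_zero (fun _ => norm_nonneg _)
    (norm_exp_mul_exp_pow_sub_exp_add_le 𝕜 a b) ?_)
  simpa using (tendsto_mul_norm_exp_mul_exp_sub_exp_add 𝕜 a b).const_mul (Real.exp (‖a‖ + ‖b‖))

end Lie

section GoldenThompson

open NormedSpace Filter Topology RCLike
open scoped Matrix.Norms.L2Operator

variable {ι 𝕜 : Type*} [Fintype ι] [DecidableEq ι] [RCLike 𝕜]

theorem exp_inv_natCast_smul_pow (A : Matrix ι ι 𝕜) {N : ℕ} (hN : N ≠ 0) :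
    exp ((N : 𝕜)⁻¹ • A) ^ N = exp A := by
  rw [← Matrix.exp_nsmul, ← Nat.cast_smul_eq_nsmul 𝕜, smul_smul,
    mul_inv_cancel₀ (Nat.cast_ne_zero.2 hN), one_smul]

/-- The Golden–Thompson inequality. -/
theorem re_trace_exp_add_le {A B : Matrix ι ι 𝕜} (hA : A.IsHermitian) (hB : B.IsHermitian) :
    re (exp (A + B)).trace ≤ re (exp A * exp B).trace := by
  cases isEmpty_or_nonempty ι
  · simp [Matrix.trace]
  have hdyadic : Tendsto (fun k : ℕ => 2 ^ k - 1) atTop atTop :=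
    tendsto_atTop_mono (fun k => Nat.le_sub_one_of_lt k.lt_two_pow_self) tendsto_id
  have hcont : Continuous fun M : Matrix ι ι 𝕜 => re M.trace :=
    continuous_re.comp continuous_id.matrix_trace
  refine le_of_tendsto ((hcont.tendsto _).comp ((tendsto_exp_mul_exp_pow 𝕜 A B).comp hdyadic))
    (Eventually.of_forall fun k => ?_)
  have hsucc : 2 ^ k - 1 + 1 = 2 ^ k := Nat.sub_add_cancel Nat.one_le_two_pow
  have hcast : ((2 ^ k - 1 : ℕ) : 𝕜) + 1 = ((2 ^ k : ℕ) : 𝕜) := by exact_mod_cast hsucc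
  have hherm {M : Matrix ι ι 𝕜} (hM : M.IsHermitian) :
      (exp (((2 ^ k : ℕ) : 𝕜)⁻¹ • M)).IsHermitian :=
    Matrix.IsHermitian.exp (hM.smul (by simp [IsSelfAdjoint]))
  have h := re_trace_mul_pow_two_pow_le (hherm hA) (hherm hB) k
  simpa only [Function.comp_apply, hsucc, hcast,
    exp_inv_natCast_smul_pow _ (pow_ne_zero k two_ne_zero)] using h

end GoldenThompson

theorem exp_le_one_add_add_sq {x c : ℝ} (hx : |x| ≤ c) (hc : c < 3) :
    Real.exp x ≤ 1 + x + (2 * (1 - c / 3))⁻¹ * x ^ 2 := by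
  have hc0 : 0 ≤ c := (abs_nonneg x).trans hx
  have hexp : HasSum (fun k : ℕ => x ^ k / (k.factorial : ℝ)) (Real.exp x) := by
    rw [Real.exp_eq_exp_ℝ]
    exact NormedSpace.expSeries_div_hasSum_exp x
  have htail := (hasSum_nat_add_iff' 2).2 hexp
  have hgeom : HasSum (fun k : ℕ => x ^ 2 / 2 * (c / 3) ^ k) (x ^ 2 / 2 * (1 - c / 3)⁻¹) :=
    (hasSum_geometric_of_lt_one (by positivity) (by linarith)).mul_left _
  have hterm (k : ℕ) : x ^ (k + 2) / ((k + 2).factorial : ℝ) ≤ x ^ 2 / 2 * (c / 3) ^ k := by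
    have hfac : (2 * 3 ^ k : ℝ) ≤ ((k + 2).factorial : ℝ) := by
      have := Nat.factorial_mul_pow_le_factorial (m := 2) (n := k)
      rw [add_comm 2 k] at this
      exact_mod_cast this
    calc x ^ (k + 2) / ((k + 2).factorial : ℝ) ≤ |x| ^ (k + 2) / ((k + 2).factorial : ℝ) := by
          rw [← abs_pow]
          gcongr
          exact le_abs_self _
      _ ≤ |x| ^ (k + 2) / (2 * 3 ^ k) := by gcongr
      _ = x ^ 2 / 2 * (|x| / 3) ^ k := by rw [pow_add, sq_abs, div_pow]; field_simp
      _ ≤ x ^ 2 / 2 * (c / 3) ^ k := by gcongr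
  have h := hasSum_le hterm htail hgeom
  simp only [Finset.sum_range_succ, Finset.sum_range_zero, Nat.factorial_zero, Nat.factorial_one,
    pow_zero, pow_one, Nat.cast_one, div_one, zero_add] at h
  rw [mul_inv]
  linarith

open NormedSpace in
theorem exp_le_one_add_add_smul_sq {A : Type*} [NormedRing A] [StarRing A] [NormedAlgebra ℝ A]
    [IsometricContinuousFunctionalCalculus ℝ A IsSelfAdjoint] [PartialOrder A] [StarOrderedRing A]
    {a : A} (ha : IsSelfAdjoint a) {c : ℝ} (hac : ‖a‖ ≤ c) (hc : c < 3) :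
    exp a ≤ 1 + a + (2 * (1 - c / 3))⁻¹ • a ^ 2 := by
  have hcfc : cfc (fun x : ℝ => 1 + x + (2 * (1 - c / 3))⁻¹ * x ^ 2) a =
      1 + a + (2 * (1 - c / 3))⁻¹ • a ^ 2 := by
    rw [cfc_add .., cfc_add .., cfc_const_mul .., cfc_pow_id .., cfc_id' .., cfc_const_one ..]
  rw [← CFC.real_exp_eq_normedSpace_exp, ← hcfc]
  exact cfc_mono fun x hx => exp_le_one_add_add_sq
    ((IsometricContinuousFunctionalCalculus.norm_spectrum_le a hx).trans hac) hc

section Loewner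

open RCLike
open scoped ComplexOrder MatrixOrder Matrix.Norms.L2Operator

variable {ι κ 𝕜 : Type*} [Fintype ι] [Fintype κ] [RCLike 𝕜]

noncomputable instance instRealNormedSpaceMatrix [DecidableEq κ] :
    NormedSpace ℝ (Matrix ι κ 𝕜) where
  norm_smul_le r A := by
    rw [real_smul_eq_coe_smul (K := 𝕜), norm_smul, norm_ofReal, Real.norm_eq_abs]

noncomputable instance instRealNormedAlgebraMatrix [DecidableEq ι] :
    NormedAlgebra ℝ (Matrix ι ι 𝕜) where
  norm_smul_le r A := by
    rw [real_smul_eq_coe_smul (K := 𝕜), norm_smul, norm_ofReal, Real.norm_eq_abs]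

instance {ι : Type*} [Finite ι] : ClosedIciTopology (Matrix ι ι 𝕜) where
  isClosed_Ici A := by
    have := Fintype.ofFinite ι
    simp only [Set.Ici, Matrix.le_iff, Matrix.posSemidef_iff_dotProduct_mulVec, Set.ofPred_and,
      Set.ofPred_forall]
    refine IsClosed.inter (isClosed_eq (by fun_prop) (by fun_prop)) (isClosed_iInter fun x =>
      isClosed_le (by fun_prop) (by fun_prop))

theorem re_trace_mul_nonneg {A B : Matrix ι ι 𝕜} (hA : 0 ≤ A) (hB : 0 ≤ B) :
    0 ≤ re (A * B).trace := by
  classical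
  obtain ⟨C, rfl⟩ := CStarAlgebra.nonneg_iff_eq_star_mul_self.1 hB
  rw [← mul_assoc, Matrix.trace_mul_comm, ← mul_assoc]
  exact (nonneg_iff.1
    (Matrix.nonneg_iff_posSemidef.1 (star_right_conjugate_nonneg hA C)).trace_nonneg).1

variable [DecidableEq ι]

theorem re_trace_mul_le_of_le_smul_one {A B : Matrix ι ι 𝕜} (hA : 0 ≤ A) {c : ℝ}
    (hB : B ≤ c • 1) : re (A * B).trace ≤ c * re A.trace := by
  have h := re_trace_mul_nonneg hA (sub_nonneg.2 hB)
  rw [mul_sub, mul_smul_comm, mul_one, Matrix.trace_sub, Matrix.trace_smul, map_sub,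
    smul_re] at h
  linarith

theorem mem_spectrum_le_re_trace {A : Matrix ι ι 𝕜} (hA : 0 ≤ A) {x : ℝ}
    (hx : x ∈ spectrum ℝ A) : x ≤ re A.trace := by
  have hpos := Matrix.nonneg_iff_posSemidef.1 hA
  have hherm := hpos.isHermitian
  rw [hherm.spectrum_real_eq_range_eigenvalues] at hx
  obtain ⟨i, rfl⟩ := hx
  rw [hherm.trace_eq_sum_eigenvalues, map_sum]
  simp only [ofReal_re]
  exact Finset.single_le_sum (fun j _ => hpos.eigenvalues_nonneg j) (Finset.mem_univ i)

open NormedSpace in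
theorem exp_mul_le_re_trace_exp_smul {A : Matrix ι ι 𝕜} (hA : A.IsHermitian) {θ t : ℝ}
    (hθ : 0 ≤ θ) (ht : ¬ A ≤ t • (1 : Matrix ι ι 𝕜)) :
    Real.exp (θ * t) ≤ re (exp (θ • A)).trace := by
  have hsa : IsSelfAdjoint A := hA
  rw [← Algebra.algebraMap_eq_smul_one, le_algebraMap_iff_spectrum_le hsa] at ht
  push Not at ht
  obtain ⟨x, hx, htx⟩ := ht
  have hsmul : IsSelfAdjoint (θ • A) := (IsSelfAdjoint.all θ).smul hsa
  have hmem : Real.exp (θ * x) ∈ spectrum ℝ (exp (θ • A)) := by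
    rw [← CFC.real_exp_eq_normedSpace_exp, ← cfc_comp_const_mul θ Real.exp A,
      cfc_map_spectrum (fun x => Real.exp (θ * x)) A]
    exact ⟨x, hx, rfl⟩
  exact (Real.exp_le_exp.2 (by gcongr)).trans (mem_spectrum_le_re_trace hsmul.exp_nonneg hmem)

theorem norm_le_iff_le_smul_one {A : Matrix ι ι 𝕜} (hA : 0 ≤ A) {c : ℝ} (hc : 0 ≤ c) :
    ‖A‖ ≤ c ↔ A ≤ c • 1 := by
  have hsa : IsSelfAdjoint A := .of_nonneg hA
  have hnorm := norm_cfc_le_iff (id : ℝ → ℝ) A hc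
  rw [cfc_id ℝ A] at hnorm
  rw [hnorm, ← Algebra.algebraMap_eq_smul_one, le_algebraMap_iff_spectrum_le hsa]
  refine forall₂_congr fun x hx => ?_
  rw [id, Real.norm_of_nonneg (spectrum_nonneg_of_nonneg hA hx)]

theorem norm_le_iff_conjTranspose_mul_self_le {A : Matrix κ ι 𝕜} {c : ℝ} (hc : 0 ≤ c) :
    ‖A‖ ≤ c ↔ Aᴴ * A ≤ (c ^ 2) • (1 : Matrix ι ι 𝕜) := by
  classical
  rw [← norm_le_iff_le_smul_one (Matrix.posSemidef_conjTranspose_mul_self A).nonneg (sq_nonneg c),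
    Matrix.l2_opNorm_conjTranspose_mul_self, ← pow_two, sq_le_sq₀ (norm_nonneg A) hc]

theorem conjTranspose_mul_self_le_norm_sq_smul_one (A : Matrix κ ι 𝕜) :
    Aᴴ * A ≤ (‖A‖ ^ 2) • 1 :=
  (norm_le_iff_conjTranspose_mul_self_le (norm_nonneg A)).1 le_rfl

theorem fromBlocks_diagonal_le_smul_one {ι κ : Type*} [Finite ι] [Finite κ] [DecidableEq ι]
    [DecidableEq κ] {A : Matrix ι ι 𝕜} {B : Matrix κ κ 𝕜} {c : ℝ} (hA : A ≤ c • 1)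
    (hB : B ≤ c • 1) : Matrix.fromBlocks A 0 0 B ≤ c • 1 := by
  have := Fintype.ofFinite ι
  have := Fintype.ofFinite κ
  obtain ⟨C, hC⟩ := CStarAlgebra.nonneg_iff_eq_star_mul_self.1 (sub_nonneg.2 hA)
  obtain ⟨D, hD⟩ := CStarAlgebra.nonneg_iff_eq_star_mul_self.1 (sub_nonneg.2 hB)
  rw [← sub_nonneg]
  convert (Matrix.posSemidef_conjTranspose_mul_self (Matrix.fromBlocks C 0 0 D)).nonneg using 1
  rw [Matrix.fromBlocks_conjTranspose, Matrix.fromBlocks_multiply, ← Matrix.fromBlocks_one,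
    Matrix.fromBlocks_smul, sub_eq_iff_eq_add, Matrix.fromBlocks_add, sub_eq_iff_eq_add.1 hC,
    sub_eq_iff_eq_add.1 hD]
  simp [Matrix.star_eq_conjTranspose]

end Loewner

section Dilation

open scoped ComplexOrder MatrixOrder Matrix.Norms.L2Operator

variable {ι κ 𝕜 : Type*} [RCLike 𝕜]

/-- The Hermitian dilation of a rectangular matrix. Its largest eigenvalue is the norm of the
matrix, so norm bounds for rectangular matrices follow from one-sided bounds for Hermitian ones. -/
def dilation (A : Matrix ι κ 𝕜) : Matrix (ι ⊕ κ) (ι ⊕ κ) 𝕜 := Matrix.fromBlocks 0 A Aᴴ 0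

theorem isHermitian_dilation (A : Matrix ι κ 𝕜) : (dilation A).IsHermitian := by
  simp [dilation, Matrix.IsHermitian, Matrix.fromBlocks_conjTranspose]

theorem dilation_sum {J : Type*} (s : Finset J) (A : J → Matrix ι κ 𝕜) :
    dilation (∑ j ∈ s, A j) = ∑ j ∈ s, dilation (A j) := by
  ext (i | i) (j | j) <;> simp [dilation, Matrix.sum_apply]

theorem continuous_dilation : Continuous (dilation : Matrix ι κ 𝕜 → _) :=
  continuous_const.matrix_fromBlocks continuous_id continuous_id.matrix_conjTranspose
    continuous_const

variable [Fintype ι] [Fintype κ] [DecidableEq ι] [DecidableEq κ]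

theorem dilation_sq (A : Matrix ι κ 𝕜) :
    dilation A ^ 2 = Matrix.fromBlocks (A * Aᴴ) 0 0 (Aᴴ * A) := by
  simp [dilation, pow_two, Matrix.fromBlocks_multiply]

theorem norm_dilation_le (A : Matrix ι κ 𝕜) : ‖dilation A‖ ≤ ‖A‖ := by
  rw [norm_le_iff_conjTranspose_mul_self_le (norm_nonneg A), (isHermitian_dilation A).eq,
    ← pow_two, dilation_sq]
  have h := conjTranspose_mul_self_le_norm_sq_smul_one Aᴴ
  rw [Matrix.conjTranspose_conjTranspose, Matrix.l2_opNorm_conjTranspose] at h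
  exact fromBlocks_diagonal_le_smul_one h (conjTranspose_mul_self_le_norm_sq_smul_one A)

theorem norm_le_of_dilation_le {A : Matrix ι κ 𝕜} {t : ℝ} (ht : 0 < t)
    (hA : dilation A ≤ t • 1) : ‖A‖ ≤ t := by
  have hpos : (t • (1 : Matrix ι ι 𝕜)).PosDef := Matrix.PosDef.one.smul ht
  have hinv : (t • (1 : Matrix ι ι 𝕜)) * (t⁻¹ • 1) = 1 := by
    rw [smul_mul_smul_comm, one_mul, mul_inv_cancel₀ ht.ne', one_smul]
  let _ := invertibleOfRightInverse _ _ hinv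
  have hblocks : t • (1 : Matrix (ι ⊕ κ) (ι ⊕ κ) 𝕜) - dilation A =
      Matrix.fromBlocks (t • 1) (-A) (-A)ᴴ (t • 1) := by
    rw [dilation, ← Matrix.fromBlocks_one, Matrix.fromBlocks_smul, sub_eq_iff_eq_add,
      Matrix.fromBlocks_add]
    simp
  rw [Matrix.le_iff, hblocks, hpos.fromBlocks₁₁, Matrix.inv_eq_right_inv hinv] at hA
  have h := smul_le_smul_of_nonneg_left (Matrix.le_iff.2 hA) ht.le
  rw [norm_le_iff_conjTranspose_mul_self_le ht.le, pow_two, ← smul_smul]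
  convert h using 1
  simp [smul_smul, ht.ne']

end Dilation

section Bernstein

open NormedSpace RCLike
open scoped ComplexOrder MatrixOrder Matrix.Norms.L2Operator

instance instMeasurableSpaceMatrix {m n α : Type*} [MeasurableSpace α] :
    MeasurableSpace (Matrix m n α) :=
  inferInstanceAs (MeasurableSpace (m → n → α))

variable {ι κ J 𝕜 S : Type*} [Fintype ι] [Fintype κ] [RCLike 𝕜] [MeasurableSpace S]
  {P : Measure S}

instance {ι κ : Type*} [Finite ι] [Finite κ] : SecondCountableTopology (Matrix ι κ 𝕜) :=
  inferInstanceAs (SecondCountableTopology (ι → κ → 𝕜))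

instance {ι κ : Type*} [Finite ι] [Finite κ] : BorelSpace (Matrix ι κ 𝕜) :=
  inferInstanceAs (BorelSpace (ι → κ → 𝕜))

theorem integral_matrix_apply [DecidableEq κ] {f : S → Matrix ι κ 𝕜} (hf : Integrable f P) (i : ι)
    (j : κ) : (∫ ω, f ω ∂P) i j = ∫ ω, f ω i j ∂P :=
  ((Matrix.entryLinearMap ℝ 𝕜 i j).toContinuousLinearMap.integral_comp_comm hf).symm

theorem integral_fromBlocks_diagonal [DecidableEq ι] [DecidableEq κ] {f : S → Matrix ι ι 𝕜}
    {g : S → Matrix κ κ 𝕜} (hfg : Integrable (fun ω => Matrix.fromBlocks (f ω) 0 0 (g ω)) P)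
    (hf : Integrable f P) (hg : Integrable g P) :
    ∫ ω, Matrix.fromBlocks (f ω) 0 0 (g ω) ∂P =
      Matrix.fromBlocks (∫ ω, f ω ∂P) 0 0 (∫ ω, g ω ∂P) := by
  ext (i | i) (j | j) <;> rw [integral_matrix_apply hfg] <;>
    simp [integral_matrix_apply hf, integral_matrix_apply hg]

theorem integral_dilation [DecidableEq ι] [DecidableEq κ] {f : S → Matrix ι κ 𝕜}
    (hd : Integrable (fun ω => dilation (f ω)) P) (hf : Integrable f P) :
    ∫ ω, dilation (f ω) ∂P = dilation (∫ ω, f ω ∂P) := by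
  ext (i | i) (j | j) <;> rw [integral_matrix_apply hd] <;>
    simp [dilation, integral_matrix_apply hf, integral_conj]

variable [DecidableEq ι]

theorem continuous_exp_matrix : Continuous (exp : Matrix ι ι 𝕜 → Matrix ι ι 𝕜) :=
  let _ : NormedAlgebra ℚ (Matrix ι ι 𝕜) := .restrictScalars ℚ ℝ _
  exp_continuous

theorem integrable_re_trace {f : S → Matrix ι ι 𝕜} (hf : Integrable f P) :
    Integrable (fun ω => re (f ω).trace) P :=
  ((reLm ∘ₗ Matrix.traceLinearMap ι ℝ 𝕜).toContinuousLinearMap).integrable_comp hf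

theorem integral_re_trace {f : S → Matrix ι ι 𝕜} (hf : Integrable f P) :
    ∫ ω, re (f ω).trace ∂P = re (∫ ω, f ω ∂P).trace :=
  ((reLm ∘ₗ Matrix.traceLinearMap ι ℝ 𝕜).toContinuousLinearMap).integral_comp_comm hf

section FiniteMeasure

variable [IsFiniteMeasure P]

theorem integrable_of_continuous_of_norm_le {E F : Type*} [NormedAddCommGroup E]
    [ProperSpace E] [MeasurableSpace E] [BorelSpace E] [NormedAddCommGroup F]
    [SecondCountableTopologyEither E F] {g : E → F} (hg : Continuous g) {f : S → E}
    (hf : Measurable f) {C : ℝ} (hC : ∀ᵐ ω ∂P, ‖f ω‖ ≤ C) : Integrable (fun ω => g (f ω)) P := by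
  obtain ⟨D, hD⟩ := ((isCompact_closedBall (0 : E) C).image hg).isBounded.exists_norm_le
  exact .of_bound (hg.stronglyMeasurable.comp_measurable hf).aestronglyMeasurable D
    (hC.mono fun ω hω => hD _ ⟨f ω, by simpa using hω, rfl⟩)

end FiniteMeasure

variable [IsProbabilityMeasure P]

theorem integral_exp_le_exp_smul_one {Y : S → Matrix ι ι 𝕜} (hY : Measurable Y)
    (hherm : ∀ ω, (Y ω).IsHermitian) {c v : ℝ} (hbdd : ∀ᵐ ω ∂P, ‖Y ω‖ ≤ c) (hc : c < 3)
    (hmean : ∫ ω, Y ω ∂P = 0) (hvar : ∫ ω, Y ω ^ 2 ∂P ≤ v • (1 : Matrix ι ι 𝕜)) :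
    ∫ ω, exp (Y ω) ∂P ≤ Real.exp ((2 * (1 - c / 3))⁻¹ * v) • (1 : Matrix ι ι 𝕜) := by
  set g : ℝ := (2 * (1 - c / 3))⁻¹
  have hg0 : 0 ≤ g := inv_nonneg.2 (by linarith)
  have hint : Integrable Y P := integrable_of_continuous_of_norm_le continuous_id hY hbdd
  have hint_sq : Integrable (fun ω => Y ω ^ 2) P :=
    integrable_of_continuous_of_norm_le (continuous_pow 2) hY hbdd
  have hint_exp : Integrable (fun ω => exp (Y ω)) P :=
    integrable_of_continuous_of_norm_le continuous_exp_matrix hY hbdd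
  calc ∫ ω, exp (Y ω) ∂P ≤ ∫ ω, (1 + Y ω + g • Y ω ^ 2) ∂P :=
        integral_mono_ae hint_exp (((integrable_const _).add hint).add (hint_sq.smul g))
          (hbdd.mono fun ω hω => exp_le_one_add_add_smul_sq (hherm ω) hω hc)
    _ = 1 + g • ∫ ω, Y ω ^ 2 ∂P := by
        rw [integral_add (f := fun ω => 1 + Y ω) ((integrable_const _).add hint)
            (g := fun ω => g • Y ω ^ 2) (hint_sq.smul g),
          integral_add (integrable_const _) hint, integral_smul, hmean]
        simp
    _ ≤ 1 + g • v • (1 : Matrix ι ι 𝕜) := by gcongr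
    _ = (g * v + 1) • (1 : Matrix ι ι 𝕜) := by rw [smul_smul, add_smul, one_smul, add_comm]
    _ ≤ Real.exp (g * v) • (1 : Matrix ι ι 𝕜) :=
        smul_le_smul_of_nonneg_right (Real.add_one_le_exp _) zero_le_one

theorem integral_re_trace_exp_add_le {X Y : S → Matrix ι ι 𝕜} (hX : Measurable X)
    (hY : Measurable Y) (hXY : IndepFun X Y P) (hXherm : ∀ ω, (X ω).IsHermitian)
    (hYherm : ∀ ω, (Y ω).IsHermitian) {C D K : ℝ} (hXbdd : ∀ᵐ ω ∂P, ‖X ω‖ ≤ C)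
    (hYbdd : ∀ᵐ ω ∂P, ‖Y ω‖ ≤ D) (hK : ∫ ω, exp (Y ω) ∂P ≤ K • (1 : Matrix ι ι 𝕜)) :
    ∫ ω, re (exp (X ω + Y ω)).trace ∂P ≤ K * ∫ ω, re (exp (X ω)).trace ∂P := by
  have hintX := integrable_of_continuous_of_norm_le continuous_exp_matrix hX hXbdd
  have hintY := integrable_of_continuous_of_norm_le continuous_exp_matrix hY hYbdd
  have hadd : ∀ᵐ ω ∂P, ‖X ω + Y ω‖ ≤ C + D := by
    filter_upwards [hXbdd, hYbdd] with ω hω hω' using norm_add_le_of_le hω hω'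
  have hind : IndepFun (fun ω => exp (X ω)) (fun ω => exp (Y ω)) P :=
    hXY.comp continuous_exp_matrix.measurable continuous_exp_matrix.measurable
  have hmul : Integrable (fun ω => exp (X ω) * exp (Y ω)) P :=
    hind.integrable_bilin hintX hintY (ContinuousLinearMap.mul ℝ (Matrix ι ι 𝕜))
  calc ∫ ω, re (exp (X ω + Y ω)).trace ∂P ≤ ∫ ω, re (exp (X ω) * exp (Y ω)).trace ∂P :=
        integral_mono (integrable_re_trace
          (integrable_of_continuous_of_norm_le continuous_exp_matrix (hX.add hY) hadd))
          (integrable_re_trace hmul) fun ω => re_trace_exp_add_le (hXherm ω) (hYherm ω)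
    _ = re ((∫ ω, exp (X ω) ∂P) * ∫ ω, exp (Y ω) ∂P).trace := by
        rw [integral_re_trace hmul]
        exact congrArg (fun M : Matrix ι ι 𝕜 => re M.trace)
          (hind.integral_bilin hintX hintY (ContinuousLinearMap.mul ℝ (Matrix ι ι 𝕜)))
    _ ≤ K * re (∫ ω, exp (X ω) ∂P).trace :=
        re_trace_mul_le_of_le_smul_one
          (integral_nonneg fun ω => (hXherm ω).isSelfAdjoint.exp_nonneg) hK
    _ = K * ∫ ω, re (exp (X ω)).trace ∂P := by rw [integral_re_trace hintX]

theorem integral_re_trace_exp_sum_le {Y : J → S → Matrix ι ι 𝕜} (hY : ∀ j, Measurable (Y j))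
    (hindep : iIndepFun Y P) (hherm : ∀ j ω, (Y j ω).IsHermitian) {C : ℝ}
    (hbdd : ∀ j, ∀ᵐ ω ∂P, ‖Y j ω‖ ≤ C) {K : J → ℝ} (hK0 : ∀ j, 0 ≤ K j)
    (hK : ∀ j, ∫ ω, exp (Y j ω) ∂P ≤ K j • (1 : Matrix ι ι 𝕜)) (s : Finset J) :
    ∫ ω, re (exp (∑ j ∈ s, Y j ω)).trace ∂P ≤ (∏ j ∈ s, K j) * Fintype.card ι := by
  classical
  induction s using Finset.induction_on with
  | empty => simp
  | insert j s hj ih =>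
    have hindep' : IndepFun (fun ω => ∑ i ∈ s, Y i ω) (Y j) P := by
      simpa only [Finset.sum_fn] using hindep.indepFun_finsetSum_of_notMem hY hj
    have hsum : ∀ᵐ ω ∂P, ‖∑ i ∈ s, Y i ω‖ ≤ ∑ _i ∈ s, C :=
      ((Finset.eventually_all s).2 fun i _ => hbdd i).mono fun ω hω => norm_sum_le_of_le s hω
    calc ∫ ω, re (exp (∑ i ∈ insert j s, Y i ω)).trace ∂P
        = ∫ ω, re (exp (∑ i ∈ s, Y i ω + Y j ω)).trace ∂P := by
          simp only [Finset.sum_insert hj, add_comm]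
      _ ≤ K j * ∫ ω, re (exp (∑ i ∈ s, Y i ω)).trace ∂P :=
          integral_re_trace_exp_add_le (Finset.measurable_fun_sum s fun i _ => hY i) (hY j)
            hindep' (fun ω => isSelfAdjoint_sum s fun i _ => hherm i ω) (hherm j) hsum (hbdd j)
            (hK j)
      _ ≤ K j * ((∏ i ∈ s, K i) * Fintype.card ι) := by gcongr; exact hK0 j
      _ = (∏ i ∈ insert j s, K i) * Fintype.card ι := by rw [Finset.prod_insert hj, mul_assoc]

theorem integral_re_trace_exp_smul_sum_le {Y : J → S → Matrix ι ι 𝕜}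
    (hY : ∀ j, Measurable (Y j)) (hindep : iIndepFun Y P) (hherm : ∀ j ω, (Y j ω).IsHermitian)
    {M : ℝ} (hbdd : ∀ j, ∀ᵐ ω ∂P, ‖Y j ω‖ ≤ M) (hmean : ∀ j, ∫ ω, Y j ω ∂P = 0) {v : J → ℝ}
    (hvar : ∀ j, ∫ ω, Y j ω ^ 2 ∂P ≤ v j • (1 : Matrix ι ι 𝕜)) (s : Finset J) {θ : ℝ}
    (hθ : 0 ≤ θ) (hθM : θ * M < 3) :
    ∫ ω, re (exp (θ • ∑ j ∈ s, Y j ω)).trace ∂P ≤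
      Real.exp ((2 * (1 - θ * M / 3))⁻¹ * (θ ^ 2 * ∑ j ∈ s, v j)) * Fintype.card ι := by
  have hherm' (j ω) : (θ • Y j ω).IsHermitian :=
    (IsSelfAdjoint.all θ).smul (hherm j ω).isSelfAdjoint
  have hbdd' (j) : ∀ᵐ ω ∂P, ‖θ • Y j ω‖ ≤ θ * M := (hbdd j).mono fun ω hω => by
    rw [norm_smul, Real.norm_of_nonneg hθ]
    gcongr
  have hmean' (j) : ∫ ω, θ • Y j ω ∂P = 0 := by rw [integral_smul, hmean, smul_zero]
  have hvar' (j) : ∫ ω, (θ • Y j ω) ^ 2 ∂P ≤ (θ ^ 2 * v j) • (1 : Matrix ι ι 𝕜) := by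
    simp only [smul_pow, integral_smul, ← smul_smul (θ ^ 2)]
    gcongr
    exact hvar j
  have hmgf (j) := integral_exp_le_exp_smul_one ((hY j).const_smul θ) (hherm' j) (hbdd' j) hθM
    (hmean' j) (hvar' j)
  have h := integral_re_trace_exp_sum_le (fun j => (hY j).const_smul θ)
    (hindep.comp _ fun _ => measurable_const_smul θ) hherm' hbdd'
    (fun j => (Real.exp_pos _).le) hmgf s
  rw [← Real.exp_sum, ← Finset.mul_sum, ← Finset.mul_sum] at h
  simpa only [Finset.smul_sum, Pi.smul_apply] using h

theorem measureReal_not_le_le_integral_re_trace_exp {Y : S → Matrix ι ι 𝕜}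
    (hherm : ∀ ω, (Y ω).IsHermitian) {θ : ℝ} (hθ : 0 ≤ θ)
    (hint : Integrable (fun ω => exp (θ • Y ω)) P) (t : ℝ) :
    P.real {ω | ¬ Y ω ≤ t • (1 : Matrix ι ι 𝕜)} ≤
      Real.exp (-(θ * t)) * ∫ ω, re (exp (θ • Y ω)).trace ∂P := by
  have hnonneg (ω) : 0 ≤ re (exp (θ • Y ω)).trace :=
    (nonneg_iff.1 (Matrix.nonneg_iff_posSemidef.1
      ((IsSelfAdjoint.all θ).smul (hherm ω).isSelfAdjoint).exp_nonneg).trace_nonneg).1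
  have hmarkov := mul_meas_ge_le_integral_of_nonneg (.of_forall hnonneg)
    (integrable_re_trace hint) (Real.exp (θ * t))
  rw [Real.exp_neg, ← div_eq_inv_mul, le_div_iff₀' (Real.exp_pos _)]
  exact (mul_le_mul_of_nonneg_left (measureReal_mono fun ω hω =>
    exp_mul_le_re_trace_exp_smul (hherm ω) hθ hω) (Real.exp_pos _).le).trans hmarkov

/-- The matrix Bernstein inequality for Hermitian matrices. -/
theorem measureReal_not_sum_le_le {Y : J → S → Matrix ι ι 𝕜} (hY : ∀ j, Measurable (Y j))
    (hindep : iIndepFun Y P) (hherm : ∀ j ω, (Y j ω).IsHermitian) {M : ℝ}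
    (hbdd : ∀ j, ∀ᵐ ω ∂P, ‖Y j ω‖ ≤ M) (hM : 0 ≤ M) (hmean : ∀ j, ∫ ω, Y j ω ∂P = 0) {v : J → ℝ}
    (hvar : ∀ j, ∫ ω, Y j ω ^ 2 ∂P ≤ v j • (1 : Matrix ι ι 𝕜)) (s : Finset J)
    (hv : 0 < ∑ j ∈ s, v j) {t : ℝ} (ht : 0 ≤ t) :
    P.real {ω | ¬ ∑ j ∈ s, Y j ω ≤ t • (1 : Matrix ι ι 𝕜)} ≤
      Fintype.card ι * Real.exp (-(t ^ 2 / 2 / (∑ j ∈ s, v j + M * t / 3))) := by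
  set V := ∑ j ∈ s, v j
  set W := V + M * t / 3 with hWdef
  have hW : 0 < W := by positivity
  set θ := t / W with hθdef
  have hθ : 0 ≤ θ := by positivity
  have hden : 1 - θ * M / 3 = V / W := by rw [hθdef, hWdef]; field_simp; ring
  have hθM : θ * M < 3 := by linarith [div_pos hv hW]
  have hsum : ∀ᵐ ω ∂P, ‖θ • ∑ j ∈ s, Y j ω‖ ≤ θ * ∑ _j ∈ s, M :=
    ((Finset.eventually_all s).2 fun j _ => hbdd j).mono fun ω hω => by
      rw [norm_smul, Real.norm_of_nonneg hθ]
      gcongr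
      exact norm_sum_le_of_le s hω
  have hint := integrable_of_continuous_of_norm_le continuous_exp_matrix
    ((Finset.measurable_fun_sum s fun j _ => hY j).const_smul θ) hsum
  calc P.real {ω | ¬ ∑ j ∈ s, Y j ω ≤ t • (1 : Matrix ι ι 𝕜)}
      ≤ Real.exp (-(θ * t)) * ∫ ω, re (exp (θ • ∑ j ∈ s, Y j ω)).trace ∂P :=
        measureReal_not_le_le_integral_re_trace_exp
          (fun ω => isSelfAdjoint_sum s fun j _ => hherm j ω) hθ hint t
    _ ≤ Real.exp (-(θ * t)) *
          (Real.exp ((2 * (1 - θ * M / 3))⁻¹ * (θ ^ 2 * V)) * Fintype.card ι) := by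
        gcongr
        exact integral_re_trace_exp_smul_sum_le hY hindep hherm hbdd hmean hvar s hθ hθM
    _ = Fintype.card ι * Real.exp (-(t ^ 2 / 2 / W)) := by
        rw [← mul_assoc, ← Real.exp_add, mul_comm, hden]
        congr 2
        rw [hθdef]
        field_simp
        ring

/-- The matrix Bernstein inequality for rectangular matrices. -/
theorem measureReal_lt_norm_sum_le [DecidableEq κ] {W : J → S → Matrix ι κ 𝕜}
    (hW : ∀ j, Measurable (W j)) (hindep : iIndepFun W P) {M : ℝ}
    (hbdd : ∀ j, ∀ᵐ ω ∂P, ‖W j ω‖ ≤ M) (hM : 0 ≤ M) (hmean : ∀ j, ∫ ω, W j ω ∂P = 0) {v : J → ℝ}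
    (hvar_left : ∀ j, ∫ ω, W j ω * (W j ω)ᴴ ∂P ≤ v j • (1 : Matrix ι ι 𝕜))
    (hvar_right : ∀ j, ∫ ω, (W j ω)ᴴ * W j ω ∂P ≤ v j • (1 : Matrix κ κ 𝕜)) (s : Finset J)
    (hv : 0 < ∑ j ∈ s, v j) {t : ℝ} (ht : 0 < t) :
    P.real {ω | t < ‖∑ j ∈ s, W j ω‖} ≤ (Fintype.card ι + Fintype.card κ) *
      Real.exp (-(t ^ 2 / 2 / (∑ j ∈ s, v j + M * t / 3))) := by
  have hmean' (j) : ∫ ω, dilation (W j ω) ∂P = 0 := by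
    rw [integral_dilation
      (integrable_of_continuous_of_norm_le continuous_dilation (hW j) (hbdd j))
      (integrable_of_continuous_of_norm_le continuous_id (hW j) (hbdd j)), hmean]
    simp [dilation]
  have hvar (j) : ∫ ω, dilation (W j ω) ^ 2 ∂P ≤ v j • (1 : Matrix (ι ⊕ κ) (ι ⊕ κ) 𝕜) := by
    have hint := integrable_of_continuous_of_norm_le (continuous_dilation.pow 2) (hW j) (hbdd j)
    simp only [Pi.pow_apply, dilation_sq] at hint ⊢
    rw [integral_fromBlocks_diagonal hint
      (integrable_of_continuous_of_norm_le (g := fun A => A * Aᴴ) (by fun_prop) (hW j) (hbdd j))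
      (integrable_of_continuous_of_norm_le (g := fun A => Aᴴ * A) (by fun_prop) (hW j) (hbdd j))]
    exact fromBlocks_diagonal_le_smul_one (hvar_left j) (hvar_right j)
  have hdil := measureReal_not_sum_le_le (fun j => continuous_dilation.measurable.comp (hW j))
    (hindep.comp _ fun _ => continuous_dilation.measurable)
    (fun j ω => isHermitian_dilation (W j ω))
    (fun j => (hbdd j).mono fun ω hω => (norm_dilation_le _).trans hω) hM hmean' hvar s hv ht.le
  simp only [Function.comp_apply, Fintype.card_sum, Nat.cast_add] at hdil
  refine (measureReal_mono fun ω hω hle => ?_).trans hdil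
  rw [← dilation_sum] at hle
  exact hω.not_ge (norm_le_of_dilation_le ht hle)

end Bernstein

section Entries

open RCLike
open scoped ComplexOrder MatrixOrder Matrix.Norms.L2Operator

variable {ι κ 𝕜 : Type*} [Fintype ι] [Fintype κ] [RCLike 𝕜]

theorem re_trace_conjTranspose_mul_self (A : Matrix ι κ 𝕜) :
    re (Aᴴ * A).trace = ∑ i, ∑ j, ‖A i j‖ ^ 2 := by
  simp only [Matrix.trace, Matrix.diag_apply, Matrix.mul_apply, Matrix.conjTranspose_apply,
    map_sum, star_def, RCLike.conj_mul, ← ofReal_pow, ofReal_re]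
  exact Finset.sum_comm

variable [DecidableEq κ]

theorem norm_sq_le_sum_norm_sq (A : Matrix ι κ 𝕜) : ‖A‖ ^ 2 ≤ ∑ i, ∑ j, ‖A i j‖ ^ 2 := by
  have hpos := (Matrix.posSemidef_conjTranspose_mul_self A).nonneg
  rw [pow_two, ← Matrix.l2_opNorm_conjTranspose_mul_self,
    norm_le_iff_le_smul_one hpos (by positivity), ← Algebra.algebraMap_eq_smul_one,
    le_algebraMap_iff_spectrum_le, ← re_trace_conjTranspose_mul_self]
  exact fun x hx => mem_spectrum_le_re_trace hpos hx

theorem sum_norm_sq_le_rank_mul_norm_sq (A : Matrix ι κ 𝕜) :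
    ∑ i, ∑ j, ‖A i j‖ ^ 2 ≤ A.rank * ‖A‖ ^ 2 := by
  have hherm := Matrix.isHermitian_conjTranspose_mul_self A
  have hle (j) : hherm.eigenvalues j ≤ ‖A‖ ^ 2 := by
    rw [pow_two, ← Matrix.l2_opNorm_conjTranspose_mul_self]
    exact (le_abs_self _).trans (IsometricContinuousFunctionalCalculus.norm_spectrum_le _
      (hherm.eigenvalues_mem_spectrum_real j))
  rw [← re_trace_conjTranspose_mul_self, hherm.trace_eq_sum_eigenvalues, map_sum,
    ← Matrix.rank_conjTranspose_mul_self A, hherm.rank_eq_card_non_zero_eigs, Fintype.card_subtype,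
    ← nsmul_eq_mul, ← Finset.sum_const, Finset.sum_filter]
  refine Finset.sum_le_sum fun j _ => ?_
  split_ifs with hj
  · simpa using hle j
  · simp [not_not.1 hj]

theorem norm_le_sqrt_card_mul_card_mul {A : Matrix ι κ 𝕜} {a : ℝ} (ha : 0 ≤ a)
    (hA : ∀ i j, ‖A i j‖ ≤ a) : ‖A‖ ≤ √(Fintype.card ι * Fintype.card κ) * a := by
  refine le_of_sq_le_sq ((norm_sq_le_sum_norm_sq A).trans ?_) (by positivity)
  calc ∑ i, ∑ j, ‖A i j‖ ^ 2 ≤ ∑ _i : ι, ∑ _j : κ, a ^ 2 := by gcongr; exact hA _ _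
    _ = (√(Fintype.card ι * Fintype.card κ) * a) ^ 2 := by
        rw [mul_pow, Real.sq_sqrt (by positivity)]
        simp [mul_assoc]

theorem norm_single_le [DecidableEq ι] (i : ι) (j : κ) (c : 𝕜) : ‖Matrix.single i j c‖ ≤ ‖c‖ := by
  refine le_of_sq_le_sq ((norm_sq_le_sum_norm_sq _).trans_eq ?_) (norm_nonneg c)
  rw [Finset.sum_eq_single i, Finset.sum_eq_single j] <;> simp +contextual [Matrix.single, eq_comm]

end Entries

section CenteredSample

open scoped ComplexOrder MatrixOrder Matrix.Norms.L2Operator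

variable {I ι κ 𝕜 : Type*} [Fintype I] [Fintype ι] [Fintype κ] [RCLike 𝕜]

theorem sum_sub_mul_conjTranspose_sub_le {ι : Type*} [Finite ι] {f : I → Matrix ι κ 𝕜}
    {A : Matrix ι κ 𝕜} (hf : ∑ i, f i = Fintype.card I • A) :
    ∑ i, (f i - A) * (f i - A)ᴴ ≤ ∑ i, f i * (f i)ᴴ := by
  have := Fintype.ofFinite ι
  have hexp : ∑ i, (f i - A) * (f i - A)ᴴ = ∑ i, f i * (f i)ᴴ - Fintype.card I • (A * Aᴴ) := by
    simp only [Matrix.conjTranspose_sub, Matrix.sub_mul, Matrix.mul_sub, Finset.sum_sub_distrib,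
      ← Matrix.sum_mul, ← Matrix.mul_sum, ← Matrix.conjTranspose_sum, hf, Finset.sum_const,
      Finset.card_univ, Matrix.conjTranspose_nsmul, Matrix.smul_mul, Matrix.mul_smul, sub_self,
      sub_zero]
  rw [hexp]
  exact sub_le_self _ (nsmul_nonneg (Matrix.posSemidef_self_mul_conjTranspose A).nonneg _)

variable [DecidableEq ι] [DecidableEq κ]

/-- The centred estimator of `X` from its single entry at `i`: under a uniformly distributed `i`,
the first term has mean `X`. -/
def centeredSample (X : Matrix ι κ 𝕜) (i : ι × κ) : Matrix ι κ 𝕜 :=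
  Fintype.card (ι × κ) • Matrix.single i.1 i.2 (X i.1 i.2) - X

theorem sum_single_apply (X : Matrix ι κ 𝕜) :
    ∑ i : ι × κ, Matrix.single i.1 i.2 (X i.1 i.2) = X := by
  rw [Fintype.sum_prod_type]
  exact (Matrix.matrix_eq_sum_single X).symm

theorem sum_centeredSample (X : Matrix ι κ 𝕜) : ∑ i, centeredSample X i = 0 := by
  simp only [centeredSample, Finset.sum_sub_distrib, ← Finset.smul_sum, sum_single_apply,
    Finset.sum_const, Finset.card_univ, sub_self]

theorem conjTranspose_centeredSample (X : Matrix ι κ 𝕜) (i : ι × κ) :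
    (centeredSample X i)ᴴ = centeredSample Xᴴ i.swap := by
  simp [centeredSample, mul_comm]

theorem norm_centeredSample_le {X : Matrix ι κ 𝕜} {a : ℝ} (ha : 0 ≤ a)
    (hX : ∀ i j, ‖X i j‖ ≤ a) (i : ι × κ) :
    ‖centeredSample X i‖ ≤
      (Fintype.card ι * Fintype.card κ + √(Fintype.card ι * Fintype.card κ)) * a := by
  have hsingle : ‖Fintype.card (ι × κ) • Matrix.single i.1 i.2 (X i.1 i.2)‖ ≤
      Fintype.card ι * Fintype.card κ * a := by
    rw [← Nat.cast_mul, ← Fintype.card_prod]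
    refine norm_nsmul_le.trans ?_
    gcongr
    exact (norm_single_le ..).trans (hX ..)
  rw [add_mul]
  exact norm_sub_le_of_le hsingle (norm_le_sqrt_card_mul_card_mul ha hX)

theorem sum_single_mul_conjTranspose_le {X : Matrix ι κ 𝕜} {a : ℝ}
    (hX : ∀ i j, ‖X i j‖ ≤ a) :
    ∑ i : ι × κ, Matrix.single i.1 i.2 (X i.1 i.2) * (Matrix.single i.1 i.2 (X i.1 i.2))ᴴ ≤
      (Fintype.card κ * a ^ 2) • (1 : Matrix ι ι 𝕜) := by
  have hE (i : ι) (j : κ) (x : 𝕜) : Matrix.single i j x * (Matrix.single i j x)ᴴ =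
      (‖x‖ ^ 2) • Matrix.single i i (1 : 𝕜) := by
    simp [RCLike.mul_conj, Matrix.smul_single, RCLike.real_smul_eq_coe_mul]
  have hpos (i : ι) : 0 ≤ Matrix.single i i (1 : 𝕜) := by
    rw [← Matrix.diagonal_single]
    exact (Matrix.PosSemidef.diagonal (Pi.single_nonneg.2 zero_le_one)).nonneg
  calc ∑ i : ι × κ, Matrix.single i.1 i.2 (X i.1 i.2) * (Matrix.single i.1 i.2 (X i.1 i.2))ᴴ
      = ∑ i : ι × κ, (‖X i.1 i.2‖ ^ 2) • Matrix.single i.1 i.1 (1 : 𝕜) := by simp only [hE]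
    _ ≤ ∑ i : ι × κ, (a ^ 2) • Matrix.single i.1 i.1 (1 : 𝕜) :=
        Finset.sum_le_sum fun i _ => smul_le_smul_of_nonneg_right
          (pow_le_pow_left₀ (norm_nonneg _) (hX ..) 2) (hpos i.1)
    _ = (Fintype.card κ * a ^ 2) • (1 : Matrix ι ι 𝕜) := by
        rw [← Finset.smul_sum, Fintype.sum_prod_type]
        simp only [Finset.sum_const, Finset.card_univ, ← Finset.smul_sum, Matrix.sum_single_one,
          ← Nat.cast_smul_eq_nsmul ℝ, smul_smul]
        rw [mul_comm]

theorem sum_centeredSample_mul_conjTranspose_le {X : Matrix ι κ 𝕜} {a : ℝ}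
    (hX : ∀ i j, ‖X i j‖ ≤ a) :
    ∑ i, centeredSample X i * (centeredSample X i)ᴴ ≤
      (Fintype.card (ι × κ) ^ 2 * (Fintype.card κ * a ^ 2)) • (1 : Matrix ι ι 𝕜) := by
  have hsum : ∑ i : ι × κ, Fintype.card (ι × κ) • Matrix.single i.1 i.2 (X i.1 i.2) =
      Fintype.card (ι × κ) • X := by rw [← Finset.smul_sum, sum_single_apply]
  refine (sum_sub_mul_conjTranspose_sub_le hsum).trans ?_
  simp only [Matrix.conjTranspose_nsmul, Matrix.smul_mul, Matrix.mul_smul, ← Finset.smul_sum]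
  simp only [← Nat.cast_smul_eq_nsmul ℝ]
  rw [smul_smul, ← pow_two, mul_smul]
  gcongr
  exact sum_single_mul_conjTranspose_le hX

theorem sum_conjTranspose_mul_centeredSample_le {X : Matrix ι κ 𝕜} {a : ℝ}
    (hX : ∀ i j, ‖X i j‖ ≤ a) :
    ∑ i, (centeredSample X i)ᴴ * centeredSample X i ≤
      (Fintype.card (ι × κ) ^ 2 * (Fintype.card ι * a ^ 2)) • (1 : Matrix κ κ 𝕜) := by
  have h := sum_centeredSample_mul_conjTranspose_le (X := Xᴴ) fun j i => by simpa using hX i j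
  rw [← (Equiv.prodComm ι κ).sum_comp, ← Fintype.card_congr (Equiv.prodComm ι κ)] at h
  simpa [← conjTranspose_centeredSample] using h

end CenteredSample

section UniformSampling

open scoped ComplexOrder MatrixOrder Matrix.Norms.L2Operator

variable {S : Type*} [MeasurableSpace S] {P : Measure S}

theorem integral_comp_of_map_eq_uniformOn {I E : Type*} [Fintype I] [MeasurableSpace I]
    [MeasurableSingletonClass I] [NormedAddCommGroup E] [NormedSpace ℝ E] [CompleteSpace E]
    {Ω : S → I} (hΩ : Measurable Ω) (hunif : P.map Ω = uniformOn Set.univ) (f : I → E) :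
    ∫ ω, f (Ω ω) ∂P = (Fintype.card I : ℝ)⁻¹ • ∑ i, f i := by
  rw [← integral_map hΩ.aemeasurable StronglyMeasurable.of_discrete.aestronglyMeasurable, hunif,
    uniformOn, ProbabilityTheory.cond, Measure.restrict_univ,
    integral_smul_measure, integral_fintype .of_finite]
  simp

variable {J ι κ 𝕜 : Type*} [Fintype J] [Fintype ι] [Fintype κ] [RCLike 𝕜] [DecidableEq ι]

theorem integral_comp_le_smul_one {I : Type*} [Fintype I] [Nonempty I] [MeasurableSpace I]
    [MeasurableSingletonClass I] {Ω : S → I} (hΩ : Measurable Ω)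
    (hunif : P.map Ω = uniformOn Set.univ) {f : I → Matrix ι ι 𝕜} {v w : ℝ}
    (hf : ∑ i, f i ≤ (Fintype.card I ^ 2 * v) • (1 : Matrix ι ι 𝕜)) (hvw : v ≤ w) :
    ∫ ω, f (Ω ω) ∂P ≤ (Fintype.card I * w) • (1 : Matrix ι ι 𝕜) := by
  rw [integral_comp_of_map_eq_uniformOn hΩ hunif, inv_smul_le_iff_of_pos (by positivity),
    smul_smul, ← mul_assoc, ← pow_two]
  refine hf.trans (smul_le_smul_of_nonneg_right ?_ zero_le_one)
  gcongr

variable [DecidableEq κ] [MeasurableSpace ι] [MeasurableSpace κ] [MeasurableSingletonClass ι]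
  [MeasurableSingletonClass κ]

theorem measureReal_lt_norm_sum_centeredSample_le [IsProbabilityMeasure P] [Nonempty J]
    [Nonempty ι] [Nonempty κ] {Ω : J → S → ι × κ} (hmeas : ∀ k, Measurable (Ω k))
    (hunif : ∀ k, P.map (Ω k) = uniformOn Set.univ) (hindep : iIndepFun Ω P)
    {X : Matrix ι κ 𝕜} {a : ℝ} (ha : 0 < a) (hX : ∀ i j, ‖X i j‖ ≤ a) {t : ℝ} (ht : 0 < t) :
    P.real {ω | t < ‖∑ k, centeredSample X (Ω k ω)‖} ≤ (Fintype.card ι + Fintype.card κ) *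
      Real.exp (-(t ^ 2 / 2 / (Fintype.card J * (Fintype.card (ι × κ) *
        (max (Fintype.card ι : ℝ) (Fintype.card κ) * a ^ 2)) +
        (Fintype.card ι * Fintype.card κ + √(Fintype.card ι * Fintype.card κ)) * a * t / 3))) := by
  set v := max (Fintype.card ι : ℝ) (Fintype.card κ) * a ^ 2
  have : 0 < v := by positivity
  have hmean (k) : ∫ ω, centeredSample X (Ω k ω) ∂P = 0 := by
    rw [integral_comp_of_map_eq_uniformOn (hmeas k) (hunif k), sum_centeredSample, smul_zero]
  have hleft (k) := integral_comp_le_smul_one (w := v) (hmeas k) (hunif k)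
    (sum_centeredSample_mul_conjTranspose_le hX)
    (mul_le_mul_of_nonneg_right (le_max_right ..) (sq_nonneg a))
  have hright (k) := integral_comp_le_smul_one (w := v) (hmeas k) (hunif k)
    (sum_conjTranspose_mul_centeredSample_le hX)
    (mul_le_mul_of_nonneg_right (le_max_left ..) (sq_nonneg a))
  have hbernstein := measureReal_lt_norm_sum_le
    (fun k => (measurable_of_finite (centeredSample X)).comp (hmeas k))
    (hindep.comp _ fun _ => measurable_of_finite (centeredSample X))
    (fun k => .of_forall fun ω => norm_centeredSample_le ha.le hX (Ω k ω)) (by positivity)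
    hmean hleft hright Finset.univ
    (Finset.sum_pos (fun _ _ => by positivity) Finset.univ_nonempty) ht
  simpa only [Function.comp_apply, Finset.sum_const, Finset.card_univ, nsmul_eq_mul]
    using hbernstein

end UniformSampling

section Sampling

open scoped Matrix.Norms.L2Operator

variable {n m : ℕ}

theorem specNorm_eq_norm (A : Matrix (Fin n) (Fin n) ℝ) : specNorm A = ‖A‖ := rfl

theorem norm_apply_le_maxNorm (X : Matrix (Fin n) (Fin n) ℝ) (i j : Fin n) :
    ‖X i j‖ ≤ maxNorm X := by
  open scoped Matrix.Norms.Elementwise in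
  exact Matrix.norm_entry_le_entrywise_sup_norm X

theorem maxNorm_nonneg (X : Matrix (Fin n) (Fin n) ℝ) : 0 ≤ maxNorm X := by
  open scoped Matrix.Norms.Elementwise in
  exact norm_nonneg X

theorem maxNorm_eq_zero {X : Matrix (Fin n) (Fin n) ℝ} : maxNorm X = 0 ↔ X = 0 := by
  open scoped Matrix.Norms.Elementwise in
  exact norm_eq_zero

theorem sampling_eq_sum_single (w : Fin m → Fin n × Fin n) (X : Matrix (Fin n) (Fin n) ℝ) :
    sampling w X = ∑ k, Matrix.single (w k).1 (w k).2 (X (w k).1 (w k).2) := by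
  ext a b
  simp only [sampling, Matrix.hadamard_apply, Matrix.sum_apply, Finset.mul_sum, Matrix.single_apply]
  refine Finset.sum_congr rfl fun k _ => ?_
  split_ifs with h
  · rw [h.1, h.2, mul_one]
  · rw [mul_zero]

theorem smul_sampling_sub_eq (hm : m ≠ 0) (w : Fin m → Fin n × Fin n)
    (X : Matrix (Fin n) (Fin n) ℝ) :
    ((m : ℝ) / (n : ℝ) ^ 2)⁻¹ • sampling w X - X = (m : ℝ)⁻¹ • ∑ k, centeredSample X (w k) := by
  simp only [sampling_eq_sum_single, centeredSample, Finset.sum_sub_distrib, ← Finset.smul_sum,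
    Finset.sum_const, Finset.card_univ, Fintype.card_prod, Fintype.card_fin,
    ← Nat.cast_smul_eq_nsmul ℝ, smul_sub, smul_smul]
  rw [inv_mul_cancel₀ (Nat.cast_ne_zero.2 hm), one_smul, inv_div, div_eq_inv_mul, Nat.cast_mul,
    pow_two]

theorem mul_le_bernstein_exponent {n m β L a τ : ℝ} (hn : 2 ≤ n) (hβ : 0 < β) (hL : 0 < L)
    (ha : 0 < a) (hm : 6 * β * n * L ≤ m) (hτ : τ = √(8 * β * n ^ 3 * L / (3 * m)) * a) :
    β * L ≤ (m * τ) ^ 2 / 2 / (m * (n * n * (n * a ^ 2)) + (n * n + n) * a * (m * τ) / 3) := by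
  have hm₀ : 0 < m := lt_of_lt_of_le (by positivity) hm
  have hτ₀ : 0 < τ := by rw [hτ]; positivity
  have hτsq : τ ^ 2 = 8 * β * n ^ 3 * L / (3 * m) * a ^ 2 := by
    rw [hτ, mul_pow, Real.sq_sqrt (by positivity)]
  have hτle : τ ≤ 2 / 3 * n * a := by
    refine le_of_sq_le_sq ?_ (by positivity)
    rw [hτsq, mul_pow]
    gcongr
    rw [div_le_iff₀ (by positivity)]
    linarith [mul_le_mul_of_nonneg_left hm (by positivity : 0 ≤ 4 / 3 * n ^ 2)]
  have hden : m * (n * n * (n * a ^ 2)) + (n * n + n) * a * (m * τ) / 3 ≤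
      4 / 3 * (m * n ^ 3 * a ^ 2) := by
    calc m * (n * n * (n * a ^ 2)) + (n * n + n) * a * (m * τ) / 3
        ≤ m * (n * n * (n * a ^ 2)) +
          (n * n + n * (n / 2)) * a * (m * (2 / 3 * n * a)) / 3 := by
          gcongr
          linarith [mul_le_mul_of_nonneg_left hn (by positivity : 0 ≤ n)]
      _ = 4 / 3 * (m * n ^ 3 * a ^ 2) := by ring
  rw [le_div_iff₀ (by positivity)]
  calc _ ≤ β * L * (4 / 3 * (m * n ^ 3 * a ^ 2)) := by gcongr
    _ = (m * τ) ^ 2 / 2 := by rw [mul_pow, hτsq]; field_simp; ring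

variable {S : Type*} [MeasurableSpace S] {P : Measure S} [IsProbabilityMeasure P]
  {Ω : Fin m → S → Fin n × Fin n} {X : Matrix (Fin n) (Fin n) ℝ} {β : ℝ}

theorem measureReal_lt_specNorm_smul_sampling_sub_le (hmeas : ∀ k, Measurable (Ω k))
    (hunif : ∀ k, P.map (Ω k) = uniformOn Set.univ) (hindep : iIndepFun Ω P) (hn : 2 ≤ n)
    (hX : X ≠ 0) (hβ : 0 < β) (hm : 6 * β * n * Real.log n ≤ m) :
    P.real {ω | √(8 * β * n ^ 3 * Real.log n / (3 * m)) * maxNorm X <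
      specNorm (((m : ℝ) / (n : ℝ) ^ 2)⁻¹ • sampling (fun k => Ω k ω) X - X)} ≤
      2 * (n : ℝ) ^ (1 - β) := by
  have hn₀ : (0 : ℝ) < n := by positivity
  have hL : 0 < Real.log n := Real.log_pos (by exact_mod_cast hn)
  have hm₀ : (0 : ℝ) < m := lt_of_lt_of_le (by positivity) hm
  have : NeZero n := ⟨by omega⟩
  have : NeZero m := ⟨by exact_mod_cast hm₀.ne'⟩
  have hX₀ : 0 < maxNorm X := (maxNorm_nonneg X).lt_of_ne' (maxNorm_eq_zero.not.2 hX)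
  set τ := √(8 * β * n ^ 3 * Real.log n / (3 * m)) * maxNorm X with hτ
  have hτ₀ : 0 < τ := by positivity
  have hexponent := mul_le_bernstein_exponent (by exact_mod_cast hn) hβ hL hX₀ hm hτ
  have htail := measureReal_lt_norm_sum_centeredSample_le hmeas hunif hindep hX₀
    (norm_apply_le_maxNorm X) (mul_pos hm₀ hτ₀)
  simp only [Fintype.card_prod, Fintype.card_fin, Nat.cast_mul, max_self,
    Real.sqrt_mul_self hn₀.le] at htail
  simp only [smul_sampling_sub_eq (NeZero.ne m), specNorm_eq_norm, norm_smul, norm_inv,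
    Real.norm_natCast, lt_inv_mul_iff₀ hm₀]
  calc _ ≤ (n + n) * Real.exp (-(β * Real.log n)) := htail.trans (by gcongr)
    _ = 2 * (n : ℝ) ^ (1 - β) := by
      rw [Real.rpow_sub hn₀, Real.rpow_one, Real.rpow_def_of_pos hn₀, Real.exp_neg,
        mul_comm (Real.log n)]
      ring

theorem one_sub_le_measureReal_specNorm_smul_sampling_sub_le (hmeas : ∀ k, Measurable (Ω k))
    (hunif : ∀ k, P.map (Ω k) = uniformOn Set.univ) (hindep : iIndepFun Ω P) (hn : 1 ≤ n)
    (hβ : 0 < β) (hm : 6 * β * n * Real.log n ≤ m) (X : Matrix (Fin n) (Fin n) ℝ) :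
    1 - 2 * (n : ℝ) ^ (1 - β) ≤
      P.real {ω | specNorm (((m : ℝ) / (n : ℝ) ^ 2)⁻¹ • sampling (fun k => Ω k ω) X - X) ≤
        √(8 * β * n ^ 3 * Real.log n / (3 * m)) * maxNorm X} := by
  rcases hn.eq_or_lt with rfl | hn
  · simpa using (show (1 - 2 : ℝ) ≤ 0 by norm_num).trans measureReal_nonneg
  by_cases hX : X = 0
  · have hle : 1 - 2 * (n : ℝ) ^ (1 - β) ≤ 1 := sub_le_self 1 (by positivity)
    simpa [hX, sampling, specNorm_eq_norm, maxNorm_eq_zero.2] using hle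
  have hmeasSet : MeasurableSet {ω | √(8 * β * n ^ 3 * Real.log n / (3 * m)) * maxNorm X <
      specNorm (((m : ℝ) / (n : ℝ) ^ 2)⁻¹ • sampling (fun k => Ω k ω) X - X)} :=
    measurable_pi_lambda (fun ω k => Ω k ω) hmeas (.of_discrete (s := {w |
      √(8 * β * n ^ 3 * Real.log n / (3 * m)) * maxNorm X <
        specNorm (((m : ℝ) / (n : ℝ) ^ 2)⁻¹ • sampling w X - X)}))
  calc 1 - 2 * (n : ℝ) ^ (1 - β) ≤ 1 - P.real _ := sub_le_sub_left
        (measureReal_lt_specNorm_smul_sampling_sub_le hmeas hunif hindep hn hX hβ hm) 1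
    _ = P.real _ := (probReal_compl_eq_one_sub hmeasSet).symm
    _ = _ := by simp only [Set.compl_ofPred, not_lt]

end Sampling

section LowRank

open scoped Matrix.Norms.L2Operator

variable {ι κ : Type*} [Fintype κ]

theorem rank_sub_le {K : Type*} [Field K] [Finite ι] (A B : Matrix ι κ K) :
    (A - B).rank ≤ A.rank + B.rank := by
  have h : LinearMap.range (A - B).mulVecLin ≤
      LinearMap.range A.mulVecLin ⊔ LinearMap.range B.mulVecLin := by
    rintro _ ⟨v, rfl⟩
    rw [Matrix.mulVecLin_apply, Matrix.sub_mulVec]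
    exact Submodule.sub_mem _ (Submodule.mem_sup_left ⟨v, rfl⟩) (Submodule.mem_sup_right ⟨v, rfl⟩)
  exact (Submodule.finrank_mono h).trans (Submodule.finrank_add_le_finrank_add_finrank _ _)

theorem exists_ne_zero_mulVec_eq_zero_of_rank_lt_card {K : Type*} [Field K] [Finite ι]
    (A : Matrix ι κ K) {T : Finset κ} (hT : A.rank < T.card) :
    ∃ c ≠ 0, (∀ k ∉ T, c k = 0) ∧ A *ᵥ c = 0 := by
  let extend := Function.ExtendByZero.linearMap K ((↑) : T → κ)
  have hker : LinearMap.ker (A.mulVecLin.rangeRestrict ∘ₗ extend) ≠ ⊥ :=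
    LinearMap.ker_ne_bot_of_finrank_lt (by simpa [Matrix.rank] using hT)
  obtain ⟨u, hu, hu₀⟩ := Submodule.exists_mem_ne_zero_of_ne_bot hker
  refine ⟨extend u, ?_, fun k hk => ?_, congrArg Subtype.val hu⟩
  · have hinj : Function.Injective extend := Function.extend_injective Subtype.val_injective _
    exact (map_ne_zero_iff extend hinj).2 hu₀
  · exact Function.extend_apply' _ _ k fun ⟨j, hj⟩ => hk (hj ▸ j.2)

theorem le_norm_diagonal_sub {𝕜 : Type*} [RCLike 𝕜] [DecidableEq κ] {d : κ → 𝕜}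
    {B : Matrix κ κ 𝕜} {T : Finset κ} (hB : B.rank < T.card) {t : ℝ} (ht : 0 ≤ t)
    (hd : ∀ k ∈ T, t ≤ ‖d k‖) : t ≤ ‖Matrix.diagonal d - B‖ := by
  obtain ⟨c, hc, hsupp, hBc⟩ := exists_ne_zero_mulVec_eq_zero_of_rank_lt_card B hB
  have hlower : t * ‖WithLp.toLp 2 c‖ ≤ ‖WithLp.toLp 2 (Matrix.diagonal d *ᵥ c)‖ := by
    refine le_of_sq_le_sq ?_ (norm_nonneg _)
    simp only [mul_pow, EuclideanSpace.norm_sq_eq, Matrix.mulVec_diagonal, norm_mul,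
      Finset.mul_sum]
    refine Finset.sum_le_sum fun k _ => ?_
    by_cases hk : k ∈ T
    · gcongr
      exact hd k hk
    · simp [hsupp k hk]
  have hupper := Matrix.l2_opNorm_mulVec (Matrix.diagonal d - B) (WithLp.toLp 2 c)
  rw [Matrix.sub_mulVec, hBc, sub_zero] at hupper
  exact le_of_mul_le_mul_right (hlower.trans hupper)
    (norm_pos_iff.2 ((WithLp.toLp_eq_zero 2).not.2 hc))

end LowRank

section Thresholding

open scoped Matrix.Norms.L2Operator

variable {n r : ℕ} {Z P Q : Matrix (Fin n) (Fin n) ℝ}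

theorem norm_conj_orthogonal (hP : P ∈ Matrix.orthogonalGroup (Fin n) ℝ)
    (hQ : Q ∈ Matrix.orthogonalGroup (Fin n) ℝ) (A : Matrix (Fin n) (Fin n) ℝ) :
    ‖P * A * Qᵀ‖ = ‖A‖ := by
  have hQ' : Qᵀ ∈ Matrix.orthogonalGroup (Fin n) ℝ := Unitary.star_mem hQ
  rw [CStarRing.norm_mul_mem_unitary _ hQ', CStarRing.norm_mem_unitary_mul _ hP]

theorem frobNorm_le_sqrt_rank_mul_specNorm (A : Matrix (Fin n) (Fin n) ℝ) :
    frobNorm A ≤ √A.rank * specNorm A := by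
  have hfrob : frobNorm A = √(∑ i, ∑ j, ‖A i j‖ ^ 2) := by
    open scoped Matrix.Norms.Frobenius in
    rw [frobNorm, Matrix.frobenius_norm_def, Real.sqrt_eq_rpow]
    norm_cast
  rw [hfrob, specNorm_eq_norm, Real.sqrt_le_left (by positivity), mul_pow,
    Real.sq_sqrt (by positivity)]
  exact sum_norm_sq_le_rank_mul_norm_sq A

/-- Eckart–Young lower bound. -/
theorem IsSVD.le_specNorm_sub {s : Fin n → ℝ} (h : IsSVD Z P s Q)
    {X : Matrix (Fin n) (Fin n) ℝ} {i : Fin n} (hX : X.rank ≤ i) : s i ≤ specNorm (Z - X) := by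
  have hP : P * Pᵀ = 1 := (Matrix.mem_orthogonalGroup_iff (Fin n) ℝ).1 h.left_mem
  have hQ : Q * Qᵀ = 1 := (Matrix.mem_orthogonalGroup_iff (Fin n) ℝ).1 h.right_mem
  have hconj : Z - X = P * (Matrix.diagonal s - Pᵀ * X * Q) * Qᵀ := by
    rw [mul_sub, sub_mul, ← h.eq]
    simp only [← mul_assoc, hP, one_mul]
    rw [mul_assoc, hQ, mul_one]
  have hrank : (Pᵀ * X * Q).rank < (Finset.Iic i).card := by
    rw [Fin.card_Iic, Nat.lt_succ_iff]
    exact ((Matrix.rank_mul_le_left ..).trans (Matrix.rank_mul_le_right ..)).trans hX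
  rw [specNorm_eq_norm, hconj, norm_conj_orthogonal h.left_mem h.right_mem]
  exact le_norm_diagonal_sub hrank (h.nonneg i) fun k hk =>
    (h.antitone (Finset.mem_Iic.1 hk)).trans (Real.le_norm_self _)

theorem IsHardThresholding.rank_le {Y : Matrix (Fin n) (Fin n) ℝ}
    (hY : IsHardThresholding r Z Y) : Y.rank ≤ r := by
  obtain ⟨P, s, Q, -, rfl⟩ := hY
  refine (Matrix.rank_mul_le_left ..).trans ((Matrix.rank_mul_le_right ..).trans ?_)
  rw [Matrix.rank_diagonal, Fintype.card_subtype]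
  calc _ ≤ (Finset.univ.filter fun i : Fin n => (i : ℕ) < r).card :=
        Finset.card_le_card fun i => by simp +contextual
    _ ≤ r := by rw [Fin.card_filter_val_lt]; exact min_le_right _ _

theorem IsHardThresholding.specNorm_sub_le {X Y : Matrix (Fin n) (Fin n) ℝ}
    (hY : IsHardThresholding r Z Y) (hX : X.rank ≤ r) : specNorm (Y - Z) ≤ specNorm (Z - X) := by
  obtain ⟨P, s, Q, h, rfl⟩ := hY
  nth_rw 1 [specNorm_eq_norm, h.eq]
  rw [← sub_mul, ← mul_sub, Matrix.diagonal_sub, norm_conj_orthogonal h.left_mem h.right_mem,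
    Matrix.l2_opNorm_diagonal]
  refine (pi_norm_le_iff_of_nonneg (norm_nonneg _)).2 fun i => ?_
  split_ifs with hi
  · rw [sub_self, norm_zero]
    exact norm_nonneg _
  · rw [zero_sub, norm_neg, Real.norm_of_nonneg (h.nonneg i)]
    exact h.le_specNorm_sub (hX.trans (not_lt.1 hi))

theorem IsHardThresholding.frobNorm_sub_le {X Y : Matrix (Fin n) (Fin n) ℝ}
    (hY : IsHardThresholding r Z Y) (hX : X.rank ≤ r) :
    frobNorm (Y - X) ≤ √(2 * r) * (2 * specNorm (Z - X)) := by
  have hrank : (Y - X).rank ≤ 2 * r :=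
    (rank_sub_le Y X).trans ((add_le_add hY.rank_le hX).trans_eq (two_mul r).symm)
  have hnorm : specNorm (Y - X) ≤ 2 * specNorm (Z - X) := calc
    specNorm (Y - X) ≤ specNorm (Y - Z) + specNorm (Z - X) := by
        simpa only [specNorm_eq_norm] using norm_sub_le_norm_sub_add_norm_sub Y Z X
    _ ≤ 2 * specNorm (Z - X) := by linarith [hY.specNorm_sub_le hX]
  refine (frobNorm_le_sqrt_rank_mul_specNorm _).trans ?_
  gcongr
  · exact norm_nonneg _
  · exact_mod_cast hrank

end Thresholding

theorem sqrt_mul_deviation_le {n r m β μ a L σ : ℝ} (hn : 0 < n) (hr : 0 ≤ r) (hm : 0 ≤ m)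
    (hβ : 0 ≤ β) (hL : 0 ≤ L) (ha : 0 ≤ a) (hσ : 0 ≤ σ) (haμ : a ≤ μ * √(r / n ^ 2) * σ) :
    √(2 * r) * (2 * (√(8 * β * n ^ 3 * L / (3 * m)) * a)) ≤
      √(64 * β * μ ^ 2 * n * r ^ 2 * L / (3 * m)) * σ := by
  refine le_of_sq_le_sq ?_ (by positivity)
  calc (√(2 * r) * (2 * (√(8 * β * n ^ 3 * L / (3 * m)) * a))) ^ 2
      = 2 * r * 4 * (8 * β * n ^ 3 * L / (3 * m)) * a ^ 2 := by
        simp only [mul_pow]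
        rw [Real.sq_sqrt (by positivity), Real.sq_sqrt (by positivity)]
        ring
    _ ≤ 2 * r * 4 * (8 * β * n ^ 3 * L / (3 * m)) * (μ * √(r / n ^ 2) * σ) ^ 2 := by gcongr
    _ = (√(64 * β * μ ^ 2 * n * r ^ 2 * L / (3 * m)) * σ) ^ 2 := by
        simp only [mul_pow]
        rw [Real.sq_sqrt (by positivity), Real.sq_sqrt (by positivity)]
        field_simp
        ring

end MatrixCompletion

open MatrixCompletion in
theorem mainTheorem7_general {n r m : ℕ} (hn : 1 ≤ n)
    (X : Matrix (Fin n) (Fin n) ℝ) (hr : X.rank ≤ r)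
    (μ₁ : ℝ) (hμ₁ : maxNorm X ≤ μ₁ * √((r : ℝ) / (n : ℝ) ^ 2) * specNorm X)
    {S : Type*} [MeasurableSpace S] (P : Measure S) [IsProbabilityMeasure P]
    (Ω : Fin m → S → Fin n × Fin n)
    (hmeas : ∀ k, Measurable (Ω k))
    (hunif : ∀ k, P.map (Ω k) = uniformOn Set.univ)
    (hindep : iIndepFun Ω P)
    (β : ℝ) (hβ : 0 < β) (hm : 6 * β * n * Real.log n ≤ m) :
    1 - 2 * (n : ℝ) ^ (1 - β) ≤
      P.real {ω | ∀ X₀ : Matrix (Fin n) (Fin n) ℝ,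
        IsHardThresholding r
          (((m : ℝ) / (n : ℝ) ^ 2)⁻¹ • sampling (fun k => Ω k ω) X) X₀ →
        frobNorm (X₀ - X) ≤
          √(64 * β * μ₁ ^ 2 * n * (r : ℝ) ^ 2 * Real.log n / (3 * m)) * specNorm X} := by
  refine (one_sub_le_measureReal_specNorm_smul_sampling_sub_le hmeas hunif hindep hn hβ hm X).trans
    (measureReal_mono fun ω hω X₀ hX₀ => ?_)
  set Z := ((m : ℝ) / (n : ℝ) ^ 2)⁻¹ • sampling (fun k => Ω k ω) X
  calc frobNorm (X₀ - X) ≤ √(2 * r) * (2 * specNorm (Z - X)) := hX₀.frobNorm_sub_le hr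
    _ ≤ √(2 * r) * (2 * (√(8 * β * n ^ 3 * Real.log n / (3 * m)) * maxNorm X)) := by
      gcongr
      exact hω
    _ ≤ √(64 * β * μ₁ ^ 2 * n * (r : ℝ) ^ 2 * Real.log n / (3 * m)) * specNorm X :=
      sqrt_mul_deviation_le (Nat.cast_pos.2 hn) r.cast_nonneg m.cast_nonneg hβ.le
        (Real.log_natCast_nonneg n) (maxNorm_nonneg X) (norm_nonneg _) hμ₁

theorem mainTheorem7 {n r m : ℕ} (hn : 1 ≤ n)
    (X : Matrix (Fin n) (Fin n) ℝ) (hr : X.rank = r)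
    (μ₁ : ℝ) (hμ₁ : MatrixCompletion.maxNorm X
      ≤ μ₁ * √((r : ℝ) / (n : ℝ) ^ 2) * MatrixCompletion.specNorm X)
    {S : Type*} [MeasurableSpace S] (P : Measure S) [IsProbabilityMeasure P]
    (Ω : Fin m → S → Fin n × Fin n)
    (hmeas : ∀ k, Measurable (Ω k))
    (hunif : ∀ k, P.map (Ω k) = uniformOn Set.univ)
    (hindep : iIndepFun Ω P)
    (β : ℝ) (hβ : 1 < β) (hm : 6 * β * n * Real.log n ≤ m) :
    1 - 2 * (n : ℝ) ^ (1 - β) ≤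
      P.real {ω | ∀ X₀ : Matrix (Fin n) (Fin n) ℝ,
        MatrixCompletion.IsHardThresholding r
          (((m : ℝ) / (n : ℝ) ^ 2)⁻¹ • MatrixCompletion.sampling (fun k => Ω k ω) X) X₀ →
        MatrixCompletion.frobNorm (X₀ - X) ≤
          √(64 * β * μ₁ ^ 2 * n * (r : ℝ) ^ 2 * Real.log n / (3 * m))
            * MatrixCompletion.specNorm X} :=
  mainTheorem7_general hn X hr.le μ₁ hμ₁ P Ω hmeas hunif hindep β (one_pos.trans hβ) hm
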